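/- Let $(M,g,A)$ be a Kähler manifold of real dimension $n\ge 4$: $g$ is a smooth Riemannian metric with Levi-Civita connection $\nabla^g$, and $A$ is a smooth $(1,1)$-tensor field with $A^2=-\mathrm{Id}$, $g(AX,AY)=g(X,Y)$ and $\nabla^g A=0$. Write $$R^g(X,Y)Z=\nabla^g_X\nabla^g_YZ-\nabla^g_Y\nabla^g_XZ-\nabla^g_{[X,Y]}Z,\qquad Ric^g(Y,Z)=\mathrm{Trace}\{X\mapsto R^g(X,Y)Z\}.$$ For a smooth 1-form $\pi$ (the generator) let $\nabla^1_XY=\nabla^g_XY-\pi(X)AY$ be the corresponding quarter-symmetric metric $A$-connection, let $\nabla^2_XY=\nabla^1_YX+[X,Y]$ be its conjugate and $\nabla^0=\frac12(\nabla^1+\nabla^2)$ its symmetric part. Its curvature tensors of the first, zero and third kind are $$R^1(X,Y)Z=\nabla^1_X\nabla^1_YZ-\nabla^1_Y\nabla^1_XZ-\nabla^1_{[X,Y]}Z,\qquad R^0(X,Y)Z=\nabla^0_X\nabla^0_YZ-\nabla^0_Y\nabla^0_XZ-\nabla^0_{[X,Y]}Z,$$ $$R^3(X,Y)Z=\nabla^2_X\nabla^1_YZ-\nabla^1_Y\nabla^2_XZ+\nabla^2_{\nabla^1_YX}Z-\nabla^1_{\nabla^2_XY}Z.$$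 Put $Ric^\theta(Y,Z)=\mathrm{Trace}\{X\mapsto R^\theta(X,Y)Z\}$ for $\theta=0,1,3$ and ${}'R^3(X,Y)=\mathrm{Trace}\{Z\mapsto R^3(X,Y)Z\}$. Then the tensor $$\begin{aligned}H^0(X,Y)Z={}&R^0(X,Y)Z+\tfrac1{n-1}\bigl(Ric^0(X,Z)Y-Ric^0(Y,Z)X\bigr)-\tfrac1{2(n-1)}\bigl(Ric^1(X,Z)Y-Ric^1(Y,Z)X\bigr)\\&-\tfrac1{4(n-1)}\bigl(Ric^3(Z,X)Y-Ric^3(Z,Y)X+{}'R^3(AZ,AX)Y-{}'R^3(AZ,AY)X\bigr)\\&+\tfrac14\bigl(2Ric^1(Y,AX)AZ+Ric^3(Z,AX)AY-Ric^3(Z,AY)AX\bigr)\\&-\tfrac14\bigl({}'R^3(AZ,X)AY-{}'R^3(AZ,Y)AX\bigr)\end{aligned}$$ is independent of the generator $\pi$: any two smooth 1-forms give the same $H^0$. Moreover, for every $\pi$, $$\begin{aligned}H^0(X,Y)Z={}&R^g(X,Y)Z+\tfrac1{4(n-1)}\bigl(Ric^g(X,Z)Y-Ric^g(Y,Z)X\bigr)\\&+\tfrac14\bigl(2Ric^g(AX,Y)AZ+Ric^g(AX,Z)AY-Ric^g(AY,Z)AX\bigr),\end{aligned}$$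 and $$H^0(X,Y)Z=\frac{n+2}4\,P(X,Y)Z-\frac{n-2}4\,W(X,Y)Z,$$ where $$W(X,Y)Z=R^g(X,Y)Z+\tfrac1{n-1}\bigl(Ric^g(X,Z)Y-Ric^g(Y,Z)X\bigr)$$ is the Weyl projective curvature tensor and $$\begin{aligned}P(X,Y)Z={}&R^g(X,Y)Z+\tfrac1{n+2}\bigl(Ric^g(X,Z)Y-Ric^g(Y,Z)X\bigr)\\&-\tfrac1{n+2}\bigl(Ric^g(X,AZ)AY-Ric^g(Y,AZ)AX+2Ric^g(X,AY)AZ\bigr)\end{aligned}$$ is the holomorphically projective curvature tensor. -/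

import Mathlib

open Bundle VectorField Module
open scoped Manifold ContDiff

set_option linter.unusedSectionVars false

noncomputable section

namespace KahlerQS

section Riemannian

variable {E : Type*} [NormedAddCommGroup E] [NormedSpace ℝ E] [FiniteDimensional ℝ E]
  {H : Type*} [TopologicalSpace H] (I : ModelWithCorners ℝ E H)
  {M : Type*} [TopologicalSpace M] [ChartedSpace H M] [IsManifold I ∞ M]

instance instFiniteDimensionalTangentSpace (x : M) : FiniteDimensional ℝ (TangentSpace I x) :=
  inferInstanceAs (FiniteDimensional ℝ E)

/-! ### The Levi-Civita connection, built from the Koszul formula -/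

section LeviCivita

variable [RiemannianBundle (fun x : M ↦ TangentSpace I x)]

/-- The function `g(X, Y)`. -/
def metric (X Y : Π x : M, TangentSpace I x) (x : M) : ℝ := inner ℝ (X x) (Y x)

/-- The Koszul expression
`(1/2) (X g(Y,Z) + Y g(X,Z) - Z g(X,Y) + g([X,Y],Z) - g([X,Z],Y) - g([Y,Z],X))`. -/
def koszul (X Y Z : Π x : M, TangentSpace I x) (x : M) : ℝ :=
  (1 / 2 : ℝ) * (d% (metric I Y Z) x (X x) + d% (metric I X Z) x (Y x)
    - d% (metric I X Y) x (Z x)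
    + inner ℝ (mlieBracket I X Y x) (Z x) - inner ℝ (mlieBracket I X Z x) (Y x)
    - inner ℝ (mlieBracket I Y Z x) (X x))

lemma metric_smul_left (f : M → ℝ) (X Y : Π x : M, TangentSpace I x) :
    metric I (f • X) Y = fun x ↦ f x * metric I X Y x := by
  ext x; simp [metric, inner_smul_left]

lemma metric_smul_right (f : M → ℝ) (X Y : Π x : M, TangentSpace I x) :
    metric I X (f • Y) = fun x ↦ f x * metric I X Y x := by
  ext x; simp [metric, inner_smul_right]

lemma metric_add_left (X X' Y : Π x : M, TangentSpace I x) :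
    metric I (X + X') Y = fun x ↦ metric I X Y x + metric I X' Y x := by
  ext x; simp [metric, inner_add_left]

lemma metric_add_right (X Y Y' : Π x : M, TangentSpace I x) :
    metric I X (Y + Y') = fun x ↦ metric I X Y x + metric I X Y' x := by
  ext x; simp [metric, inner_add_right]

variable [IsContMDiffRiemannianBundle I ∞ E (fun x : M ↦ TangentSpace I x)]

lemma metric_mdifferentiableAt {X Y : Π x : M, TangentSpace I x} {x : M}
    (hX : MDiffAt (T% X) x) (hY : MDiffAt (T% Y) x) : MDiffAt (metric I X Y) x :=
  MDifferentiableAt.inner_bundle hX hY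

lemma koszul_tensorial_left {Y Z : Π x : M, TangentSpace I x} {x : M}
    (hY : MDiffAt (T% Y) x) (hZ : MDiffAt (T% Z) x) :
    TensorialAt I E (fun X ↦ koszul I X Y Z x) x where
  smul {f X} hf hX := by
    simp only [koszul, metric_smul_left,
      mvfderiv_fun_mul hf (metric_mdifferentiableAt I hX hY),
      mvfderiv_fun_mul hf (metric_mdifferentiableAt I hX hZ),
      mlieBracket_smul_left hf hX]
    simp [inner_add_left, inner_smul_left, inner_smul_right, metric, real_inner_comm]
    ring
  add {X X'} hX hX' := by
    simp only [koszul, metric_add_left,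
      mvfderiv_fun_add (metric_mdifferentiableAt I hX hY) (metric_mdifferentiableAt I hX' hY),
      mvfderiv_fun_add (metric_mdifferentiableAt I hX hZ) (metric_mdifferentiableAt I hX' hZ),
      mlieBracket_add_left hX hX']
    simp [inner_add_left, inner_add_right]
    ring

lemma koszul_tensorial_right {X Y : Π x : M, TangentSpace I x} {x : M}
    (hX : MDiffAt (T% X) x) (hY : MDiffAt (T% Y) x) :
    TensorialAt I E (fun Z ↦ koszul I X Y Z x) x where
  smul {f Z} hf hZ := by
    simp only [koszul, metric_smul_right,
      mvfderiv_fun_mul hf (metric_mdifferentiableAt I hX hZ),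
      mvfderiv_fun_mul hf (metric_mdifferentiableAt I hY hZ),
      mlieBracket_smul_right hf hZ]
    simp [inner_add_left, inner_smul_left, inner_smul_right, metric, real_inner_comm]
    ring
  add {Z Z'} hZ hZ' := by
    simp only [koszul, metric_add_right,
      mvfderiv_fun_add (metric_mdifferentiableAt I hX hZ) (metric_mdifferentiableAt I hX hZ'),
      mvfderiv_fun_add (metric_mdifferentiableAt I hY hZ) (metric_mdifferentiableAt I hY hZ'),
      mlieBracket_add_right hZ hZ']
    simp [inner_add_left, inner_add_right]
    ring

/-- The bilinear form `(X, Z) ↦ g(∇_X Y, Z)` on the tangent space at `x`, given by the Koszul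
expression. -/
def koszulForm {Y : Π x : M, TangentSpace I x} {x : M} (hY : MDiffAt (T% Y) x) :
    TangentSpace I x →L[ℝ] TangentSpace I x →L[ℝ] ℝ :=
  TensorialAt.mkHom₂ (I := I) (F := E) (F' := E) (fun X Z ↦ koszul I X Y Z x) x
    (fun _ hZ ↦ koszul_tensorial_left I hY hZ) (fun _ hX ↦ koszul_tensorial_right I hX hY)

lemma koszulForm_apply {X Y Z : Π x : M, TangentSpace I x} {x : M} (hX : MDiffAt (T% X) x)
    (hY : MDiffAt (T% Y) x) (hZ : MDiffAt (T% Z) x) :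
    koszulForm I hY (X x) (Z x) = koszul I X Y Z x :=
  TensorialAt.mkHom₂_apply _ _ hX hZ

open Classical in
/-- `leviCivitaFun I Y x v` is `∇_v Y` at `x`: the vector which represents `koszulForm I hY v`
with respect to the metric (set to `0` if `Y` is not differentiable at `x`). -/
def leviCivitaFun (Y : Π x : M, TangentSpace I x) (x : M) :
    TangentSpace I x →L[ℝ] TangentSpace I x :=
  if hY : MDiffAt (T% Y) x then
    ∑ i, ((koszulForm I hY).flip (stdOrthonormalBasis ℝ (TangentSpace I x) i)).smulRight
      (stdOrthonormalBasis ℝ (TangentSpace I x) i)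
  else 0

lemma inner_leviCivitaFun {Y : Π x : M, TangentSpace I x} {x : M} (hY : MDiffAt (T% Y) x)
    (v z : TangentSpace I x) : inner ℝ (leviCivitaFun I Y x v) z = koszulForm I hY v z := by
  conv_rhs => rw [← (stdOrthonormalBasis ℝ (TangentSpace I x)).sum_repr' z]
  simp only [leviCivitaFun, hY, dif_pos]
  simp [sum_inner, inner_smul_left, mul_comm]

lemma inner_leviCivitaFun_eq_koszul {X Y Z : Π x : M, TangentSpace I x} {x : M}
    (hX : MDiffAt (T% X) x) (hY : MDiffAt (T% Y) x) (hZ : MDiffAt (T% Z) x) :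
    inner ℝ (leviCivitaFun I Y x (X x)) (Z x) = koszul I X Y Z x := by
  rw [inner_leviCivitaFun I hY, koszulForm_apply I hX hY hZ]

/-- Two vectors at `x` agree if they have the same products with all `Z x`. -/
lemma ext_inner_fields {x : M} {v w : TangentSpace I x}
    (h : ∀ Z : Π x : M, TangentSpace I x, MDiffAt (T% Z) x →
      inner ℝ v (Z x) = inner ℝ w (Z x)) : v = w := by
  refine ext_inner_right ℝ fun z ↦ ?_
  simpa using h (FiberBundle.extend E z) (FiberBundle.mdifferentiableAt_extend ..)

/-- Two endomorphisms of the tangent space at `x` agree if they agree on all `X x`. -/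
lemma ext_fields {x : M} {S T : TangentSpace I x →L[ℝ] TangentSpace I x}
    (h : ∀ X : Π x : M, TangentSpace I x, MDiffAt (T% X) x → S (X x) = T (X x)) : S = T := by
  ext1 v
  simpa using h (FiberBundle.extend E v) (FiberBundle.mdifferentiableAt_extend ..)

lemma koszul_add_middle {X Y Y' Z : Π x : M, TangentSpace I x} {x : M}
    (hX : MDiffAt (T% X) x) (hY : MDiffAt (T% Y) x) (hY' : MDiffAt (T% Y') x)
    (hZ : MDiffAt (T% Z) x) :
    koszul I X (Y + Y') Z x = koszul I X Y Z x + koszul I X Y' Z x := by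
  simp only [koszul, metric_add_left, metric_add_right,
    mvfderiv_fun_add (metric_mdifferentiableAt I hX hY) (metric_mdifferentiableAt I hX hY'),
    mvfderiv_fun_add (metric_mdifferentiableAt I hY hZ) (metric_mdifferentiableAt I hY' hZ),
    mlieBracket_add_right hY hY', mlieBracket_add_left hY hY']
  simp [inner_add_left, inner_add_right]
  ring

lemma koszul_smul_middle {X Y Z : Π x : M, TangentSpace I x} {f : M → ℝ} {x : M}
    (hX : MDiffAt (T% X) x) (hY : MDiffAt (T% Y) x) (hf : MDiffAt f x)
    (hZ : MDiffAt (T% Z) x) :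
    koszul I X (f • Y) Z x = f x * koszul I X Y Z x + d% f x (X x) * inner ℝ (Y x) (Z x) := by
  simp only [koszul, metric_smul_left, metric_smul_right,
    mvfderiv_fun_mul hf (metric_mdifferentiableAt I hX hY),
    mvfderiv_fun_mul hf (metric_mdifferentiableAt I hY hZ),
    mlieBracket_smul_right hf hY, mlieBracket_smul_left hf hY]
  simp [inner_add_left, inner_smul_left, inner_smul_right, metric, real_inner_comm]
  ring

lemma isCovariantDerivativeOn_leviCivitaFun :
    IsCovariantDerivativeOn E (leviCivitaFun I : (Π x : M, TangentSpace I x) → _) where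
  add {Y Y' x} hY hY' _ := by
    have hs : MDiffAt (T% (Y + Y')) x := mdifferentiableAt_add_section hY hY'
    refine ext_fields I fun X hX ↦ ext_inner_fields I fun Z hZ ↦ ?_
    rw [inner_leviCivitaFun_eq_koszul I hX hs hZ, koszul_add_middle I hX hY hY' hZ]
    simp [inner_add_left, inner_leviCivitaFun_eq_koszul I hX hY hZ,
      inner_leviCivitaFun_eq_koszul I hX hY' hZ]
  leibniz {Y f x} hY hf _ := by
    have hs : MDiffAt (T% (f • Y)) x := hf.smul_section hY
    refine ext_fields I fun X hX ↦ ext_inner_fields I fun Z hZ ↦ ?_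
    rw [inner_leviCivitaFun_eq_koszul I hX hs hZ, koszul_smul_middle I hX hY hf hZ]
    simp [inner_add_left, inner_smul_left, inner_leviCivitaFun_eq_koszul I hX hY hZ]

variable (M) in
/-- The Levi-Civita connection `∇^g` of the Riemannian manifold `M`: `leviCivita I M Y x (X x)` is
`∇^g_X Y` at `x`. -/
def leviCivita : CovariantDerivative I E (fun x : M ↦ TangentSpace I x) where
  toFun := leviCivitaFun I
  isCovariantDerivativeOnUniv := isCovariantDerivativeOn_leviCivitaFun I

/-- The Levi-Civita connection is torsion-free. -/
theorem leviCivita_torsion : (leviCivita I M).torsion = 0 := by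
  rw [CovariantDerivative.torsion_eq_zero_iff]
  intro X Y x hX hY
  refine ext_inner_fields I fun Z hZ ↦ ?_
  have h1 := inner_leviCivitaFun_eq_koszul I hX hY hZ
  have h2 := inner_leviCivitaFun_eq_koszul I hY hX hZ
  have h3 : metric I X Y = metric I Y X := by ext; simp [metric, real_inner_comm]
  have h4 : mlieBracket I Y X x = - mlieBracket I X Y x := mlieBracket_swap_apply
  change inner ℝ (leviCivitaFun I Y x (X x) - leviCivitaFun I X x (Y x)) (Z x) = _
  rw [inner_sub_left, h1, h2, koszul, koszul, h3, h4, inner_neg_left]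
  ring

/-- The Levi-Civita connection is compatible with the metric:
`X g(Y, Z) = g(∇_X Y, Z) + g(Y, ∇_X Z)`. -/
theorem leviCivita_metric {X Y Z : Π x : M, TangentSpace I x} {x : M}
    (hX : MDiffAt (T% X) x) (hY : MDiffAt (T% Y) x) (hZ : MDiffAt (T% Z) x) :
    d% (metric I Y Z) x (X x) =
      inner ℝ (leviCivita I M Y x (X x)) (Z x) + inner ℝ (Y x) (leviCivita I M Z x (X x)) := by
  have h1 := inner_leviCivitaFun_eq_koszul I hX hY hZ
  have h2 := inner_leviCivitaFun_eq_koszul I hX hZ hY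
  have h3 : metric I Z Y = metric I Y Z := by ext; simp [metric, real_inner_comm]
  have h4 : mlieBracket I Z Y x = - mlieBracket I Y Z x := mlieBracket_swap_apply
  change d% (metric I Y Z) x (X x) = inner ℝ (leviCivitaFun I Y x (X x)) (Z x)
    + inner ℝ (Y x) (leviCivitaFun I Z x (X x))
  rw [real_inner_comm (leviCivitaFun I Z x (X x)), h1, h2, koszul, koszul, h3, h4, inner_neg_left]
  ring

end LeviCivita

/-! ### Operators on vector fields, curvature tensors and traces -/

section Curvature

variable {I}

/-- The operator `(X, Y) ↦ ∇_X Y` of a linear connection `∇` on `TM`. -/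
def nabla (cov : CovariantDerivative I E (fun x : M ↦ TangentSpace I x))
    (X Y : Π x : M, TangentSpace I x) : Π x : M, TangentSpace I x :=
  fun x ↦ cov Y x (X x)

/-- The conjugate connection `(X, Y) ↦ ∇_Y X + [X, Y]`; its torsion is minus that of `∇`. -/
def conjNabla (cov : CovariantDerivative I E (fun x : M ↦ TangentSpace I x))
    (X Y : Π x : M, TangentSpace I x) : Π x : M, TangentSpace I x :=
  nabla cov Y X + mlieBracket I X Y

/-- The symmetric (torsion-free) part of `∇`: half the sum of `∇` and its conjugate. -/
def symNabla (cov : CovariantDerivative I E (fun x : M ↦ TangentSpace I x))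
    (X Y : Π x : M, TangentSpace I x) : Π x : M, TangentSpace I x :=
  (1 / 2 : ℝ) • (nabla cov X Y + conjNabla cov X Y)

/-- `D_X D_Y Z - D_Y D_X Z - D_{[X,Y]} Z`. -/
def curvatureOp
    (D : (Π x : M, TangentSpace I x) → (Π x : M, TangentSpace I x) → Π x : M, TangentSpace I x)
    (X Y Z : Π x : M, TangentSpace I x) : Π x : M, TangentSpace I x :=
  D X (D Y Z) - D Y (D X Z) - D (mlieBracket I X Y) Z

/-- Curvature tensor of the zero kind: the curvature of the symmetric part of `∇`. -/
def curvature0 (cov : CovariantDerivative I E (fun x : M ↦ TangentSpace I x))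
    (X Y Z : Π x : M, TangentSpace I x) : Π x : M, TangentSpace I x :=
  curvatureOp (symNabla cov) X Y Z

/-- Curvature tensor of the first kind: the usual curvature of `∇`. -/
def curvature1 (cov : CovariantDerivative I E (fun x : M ↦ TangentSpace I x))
    (X Y Z : Π x : M, TangentSpace I x) : Π x : M, TangentSpace I x :=
  curvatureOp (nabla cov) X Y Z

/-- Curvature tensor of the third kind: with `∇' = conjNabla`,
`∇'_X ∇_Y Z - ∇_Y ∇'_X Z + ∇'_{∇_Y X} Z - ∇_{∇'_X Y} Z`. -/
def curvature3 (cov : CovariantDerivative I E (fun x : M ↦ TangentSpace I x))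
    (X Y Z : Π x : M, TangentSpace I x) : Π x : M, TangentSpace I x :=
  conjNabla cov X (nabla cov Y Z) - nabla cov Y (conjNabla cov X Z)
    + conjNabla cov (nabla cov Y X) Z - nabla cov (conjNabla cov X Y) Z

/-- The trace `∑ bⁱ(Φ(bᵢ))` of a self-map `Φ` of the tangent space at `x` (which is linear in all
uses below). -/
def traceAt (x : M) (Φ : TangentSpace I x → TangentSpace I x) : ℝ :=
  ∑ i, (finBasis ℝ (TangentSpace I x)).repr (Φ (finBasis ℝ (TangentSpace I x) i)) i

/-- On linear maps, `traceAt` is the trace. -/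
lemma traceAt_linearMap (x : M) (Φ : TangentSpace I x →ₗ[ℝ] TangentSpace I x) :
    traceAt x Φ = LinearMap.trace ℝ (TangentSpace I x) Φ := by
  rw [LinearMap.trace_eq_matrix_trace ℝ (finBasis ℝ (TangentSpace I x)) Φ]
  simp [traceAt, Matrix.trace, LinearMap.toMatrix_apply]

/-- `Ric(Y, Z) = Trace {X ↦ K(X, Y)Z}`, where tangent vectors `X` at `x` are extended to vector
fields. -/
def ricci
    (K : (Π x : M, TangentSpace I x) → (Π x : M, TangentSpace I x) →
      (Π x : M, TangentSpace I x) → Π x : M, TangentSpace I x)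
    (Y Z : Π x : M, TangentSpace I x) (x : M) : ℝ :=
  traceAt x fun v ↦ K (FiberBundle.extend E v) Y Z x

/-- `'K(X, Y) = Trace {Z ↦ K(X, Y)Z}`, where tangent vectors `Z` at `x` are extended to vector
fields. -/
def primeTrace
    (K : (Π x : M, TangentSpace I x) → (Π x : M, TangentSpace I x) →
      (Π x : M, TangentSpace I x) → Π x : M, TangentSpace I x)
    (X Y : Π x : M, TangentSpace I x) (x : M) : ℝ :=
  traceAt x fun v ↦ K X Y (FiberBundle.extend E v) x

/-- The vector field `A X`, for a field of endomorphisms `A`. -/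
def app (A : Π x : M, TangentSpace I x →L[ℝ] TangentSpace I x)
    (X : Π x : M, TangentSpace I x) : Π x : M, TangentSpace I x :=
  fun x ↦ A x (X x)

/-- Smoothness of a vector field at a point. -/
def SmoothFieldAt (X : Π x : M, TangentSpace I x) (x : M) : Prop :=
  ContMDiffAt I I.tangent ∞ (fun y ↦ (X y : TangentBundle I M)) x

/-- Smoothness of a 1-form. -/
def SmoothOneForm (ϖ : Π x : M, TangentSpace I x →L[ℝ] ℝ) : Prop :=
  ContMDiff I (I.prod 𝓘(ℝ, E →L[ℝ] ℝ)) ∞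
    (fun x ↦ TotalSpace.mk' (E →L[ℝ] ℝ)
      (E := fun x : M ↦ TangentSpace I x →L[ℝ] Bundle.Trivial M ℝ x) x (ϖ x))

variable [RiemannianBundle (fun x : M ↦ TangentSpace I x)]
  [IsContMDiffRiemannianBundle I ∞ E (fun x : M ↦ TangentSpace I x)]

/-- `(M, g, A)` is an almost Hermitian manifold: `A` is a smooth `(1,1)` tensor with `A² = -1` and
`g(AX, AY) = g(X, Y)`. -/
structure IsAlmostHermitian (A : Π x : M, TangentSpace I x →L[ℝ] TangentSpace I x) : Prop where
  smooth : ContMDiff I (I.prod 𝓘(ℝ, E →L[ℝ] E)) ∞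
    (fun x ↦ TotalSpace.mk' (E →L[ℝ] E)
      (E := fun x : M ↦ TangentSpace I x →L[ℝ] TangentSpace I x) x (A x))
  sq : ∀ (x : M) (v : TangentSpace I x), A x (A x v) = -v
  isometry : ∀ (x : M) (v w : TangentSpace I x), inner ℝ (A x v) (A x w) = inner ℝ v w

/-- `(M, g, A)` is a Kähler manifold: almost Hermitian with `∇^g A = 0`, that is
`∇^g_v (A Y) = A ∇^g_v Y`. -/
structure IsKahler (A : Π x : M, TangentSpace I x →L[ℝ] TangentSpace I x) : Prop
    extends IsAlmostHermitian A where
  parallel : ∀ (Y : Π x : M, TangentSpace I x) (x : M), MDiffAt (T% Y) x →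
    ∀ v : TangentSpace I x, leviCivita I M (app A Y) x v = A x (leviCivita I M Y x v)

/-- The quarter-symmetric metric `A`-connection with generator `ϖ`:
`∇_X Y = ∇^g_X Y - ϖ(X) A Y`. -/
def quarterSymmetric (A : Π x : M, TangentSpace I x →L[ℝ] TangentSpace I x)
    (ϖ : Π x : M, TangentSpace I x →L[ℝ] ℝ) :
    CovariantDerivative I E (fun x : M ↦ TangentSpace I x) where
  toFun Y x := leviCivita I M Y x - (ϖ x).smulRight (A x (Y x))
  isCovariantDerivativeOnUniv :=
    { add := fun {Y Y' x} hY hY' _ ↦ by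
        ext1 v
        simp [(leviCivita I M).isCovariantDerivativeOnUniv.add hY hY']
        abel
      leibniz := fun {Y f x} hY hf _ ↦ by
        ext1 v
        simp [(leviCivita I M).isCovariantDerivativeOnUniv.leibniz hY hf]
        module }

variable (I) in
/-- The Riemannian curvature tensor `R^g`. -/
def riemann (X Y Z : Π x : M, TangentSpace I x) : Π x : M, TangentSpace I x :=
  curvature1 (leviCivita I M) X Y Z

variable (I) in
/-- The Ricci tensor `Ric^g`. -/
def ricciG (Y Z : Π x : M, TangentSpace I x) (x : M) : ℝ := ricci (riemann I) Y Z x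

end Curvature

end Riemannian

/-! ### The tensors `W`, `P` and `H⁰` on an `n`-dimensional manifold -/

section Tensors

variable {n : ℕ} {M : Type*} [TopologicalSpace M]
  [ChartedSpace (EuclideanSpace ℝ (Fin n)) M] [IsManifold (𝓡 n) ∞ M]
  [RiemannianBundle (fun x : M ↦ TangentSpace (𝓡 n) x)]
  [IsContMDiffRiemannianBundle (𝓡 n) ∞ (EuclideanSpace ℝ (Fin n))
    (fun x : M ↦ TangentSpace (𝓡 n) x)]

/-- The Weyl projective curvature tensor
`W(X,Y)Z = R^g(X,Y)Z + (1/(n-1)) (Ric^g(X,Z)Y - Ric^g(Y,Z)X)`. -/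
def weylProjective (X Y Z : Π x : M, TangentSpace (𝓡 n) x) (x : M) : TangentSpace (𝓡 n) x :=
  riemann (𝓡 n) X Y Z x
    + (1 / ((n : ℝ) - 1)) • (ricciG (𝓡 n) X Z x • Y x - ricciG (𝓡 n) Y Z x • X x)

/-- The holomorphically projective curvature tensor
`P(X,Y)Z = R^g(X,Y)Z + (1/(n+2)) (Ric^g(X,Z)Y - Ric^g(Y,Z)X)
  - (1/(n+2)) (Ric^g(X,AZ)AY - Ric^g(Y,AZ)AX + 2 Ric^g(X,AY)AZ)`. -/
def holProjective (A : Π x : M, TangentSpace (𝓡 n) x →L[ℝ] TangentSpace (𝓡 n) x)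
    (X Y Z : Π x : M, TangentSpace (𝓡 n) x) (x : M) : TangentSpace (𝓡 n) x :=
  riemann (𝓡 n) X Y Z x
    + (1 / ((n : ℝ) + 2)) • (ricciG (𝓡 n) X Z x • Y x - ricciG (𝓡 n) Y Z x • X x)
    - (1 / ((n : ℝ) + 2)) •
      (ricciG (𝓡 n) X (app A Z) x • app A Y x - ricciG (𝓡 n) Y (app A Z) x • app A X x
        + (2 * ricciG (𝓡 n) X (app A Y) x) • app A Z x)

/-- The tensor `H⁰` of the quarter-symmetric connection with generator `ϖ`; `R0`, `Ric0`, `Ric1`,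
`Ric3`, `R3'` below are the curvature tensor of the zero kind, the Ricci tensors of the zero, first
and third kind, and the trace `(X, Y) ↦ Trace {Z ↦ R³(X,Y)Z}`. -/
def tensorH0 (A : Π x : M, TangentSpace (𝓡 n) x →L[ℝ] TangentSpace (𝓡 n) x)
    (ϖ : Π x : M, TangentSpace (𝓡 n) x →L[ℝ] ℝ)
    (X Y Z : Π x : M, TangentSpace (𝓡 n) x) (x : M) : TangentSpace (𝓡 n) x :=
  let R0 := curvature0 (quarterSymmetric A ϖ)
  let Ric0 := ricci (curvature0 (quarterSymmetric A ϖ))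
  let Ric1 := ricci (curvature1 (quarterSymmetric A ϖ))
  let Ric3 := ricci (curvature3 (quarterSymmetric A ϖ))
  let R3' := primeTrace (curvature3 (quarterSymmetric A ϖ))
  R0 X Y Z x
    + (1 / ((n : ℝ) - 1)) • (Ric0 X Z x • Y x - Ric0 Y Z x • X x)
    - (1 / (2 * ((n : ℝ) - 1))) • (Ric1 X Z x • Y x - Ric1 Y Z x • X x)
    - (1 / (4 * ((n : ℝ) - 1))) •
      (Ric3 Z X x • Y x - Ric3 Z Y x • X x
        + R3' (app A Z) (app A X) x • Y x - R3' (app A Z) (app A Y) x • X x)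
    + (1 / 4 : ℝ) •
      ((2 * Ric1 Y (app A X) x) • app A Z x
        + Ric3 Z (app A X) x • app A Y x - Ric3 Z (app A Y) x • app A X x)
    - (1 / 4 : ℝ) •
      (R3' (app A Z) X x • app A Y x - R3' (app A Z) Y x • app A X x)

end Tensors

end KahlerQS

end

noncomputable section

namespace KahlerQS

section Smoothness

variable {E : Type*} [NormedAddCommGroup E] [NormedSpace ℝ E] [FiniteDimensional ℝ E]
  {H : Type*} [TopologicalSpace H] {I : ModelWithCorners ℝ E H}
  {M : Type*} [TopologicalSpace M] [ChartedSpace H M] [IsManifold I ∞ M]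

open Filter Topology

lemma SmoothFieldAt.mdifferentiableAt {X : Π x : M, TangentSpace I x} {x : M}
    (hX : SmoothFieldAt X x) : MDiffAt (T% X) x :=
  ContMDiffAt.mdifferentiableAt hX (by simp)

lemma SmoothFieldAt.eventually_mdifferentiableAt {X : Π x : M, TangentSpace I x} {x : M}
    (hX : SmoothFieldAt X x) : ∀ᶠ y in 𝓝 x, MDiffAt (T% X) y := by
  have h : ContMDiffAt I I.tangent 1 (fun y ↦ (X y : TangentBundle I M)) x :=
    ContMDiffAt.of_le hX (by simp)
  filter_upwards [(contMDiffAt_iff_contMDiffAt_nhds (by simp)).1 h] with y hy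
  exact hy.mdifferentiableAt (by simp)

lemma eventually_mdifferentiableAt_of_contMDiffAt {f : M → ℝ} {x : M}
    (hf : ContMDiffAt I 𝓘(ℝ) ∞ f x) : ∀ᶠ y in 𝓝 x, MDiffAt f y := by
  have h : ContMDiffAt I 𝓘(ℝ) 1 f x := hf.of_le (by simp)
  filter_upwards [(contMDiffAt_iff_contMDiffAt_nhds (by simp)).1 h] with y hy
  exact hy.mdifferentiableAt (by simp)

lemma smoothFieldAt_extend {x : M} (v : TangentSpace I x) :
    SmoothFieldAt (FiberBundle.extend E v) x :=
  FiberBundle.contMDiffAt_extend ..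

lemma SmoothFieldAt.congr {X Y : Π x : M, TangentSpace I x} {x : M}
    (hX : SmoothFieldAt X x) (h : Y =ᶠ[𝓝 x] X) : SmoothFieldAt Y x := by
  refine ContMDiffAt.congr_of_eventuallyEq hX ?_
  filter_upwards [h] with y hy
  rw [hy]

lemma SmoothFieldAt.sub {X Y : Π x : M, TangentSpace I x} {x : M}
    (hX : SmoothFieldAt X x) (hY : SmoothFieldAt Y x) : SmoothFieldAt (X - Y) x :=
  ContMDiffAt.sub_section hX hY

lemma SmoothFieldAt.smul {f : M → ℝ} {X : Π x : M, TangentSpace I x} {x : M}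
    (hX : SmoothFieldAt X x) (hf : ContMDiffAt I 𝓘(ℝ) ∞ f x) : SmoothFieldAt (f • X) x :=
  ContMDiffAt.smul_section hf hX

lemma SmoothFieldAt.const_smul (a : ℝ) {X : Π x : M, TangentSpace I x} {x : M}
    (hX : SmoothFieldAt X x) : SmoothFieldAt (a • X) x :=
  ContMDiffAt.const_smul_section hX

lemma SmoothFieldAt.mlieBracket {X Y : Π x : M, TangentSpace I x} {x : M}
    (hX : SmoothFieldAt X x) (hY : SmoothFieldAt Y x) :
    SmoothFieldAt (mlieBracket I X Y) x := by
  have : CompleteSpace E := FiniteDimensional.complete ℝ E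
  have : IsManifold I (minSmoothness ℝ 2) M := by
    simp only [minSmoothness_of_isRCLikeNormedField]
    infer_instance
  have : IsManifold I (((⊤ : ℕ∞) : WithTop ℕ∞) + 1) M := by
    simpa using ‹IsManifold I ∞ M›
  exact ContMDiffAt.mlieBracket_vectorField (m := ⊤) (n := ⊤) hX hY (by simp)

lemma SmoothFieldAt.mvfderiv {f : M → ℝ} {X : Π x : M, TangentSpace I x} {x : M}
    (hX : SmoothFieldAt X x) (hf : ContMDiffAt I 𝓘(ℝ) ∞ f x) :
    ContMDiffAt I 𝓘(ℝ) ∞ (fun y ↦ d% f y (X y)) x := by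
  have h : ContMDiffAt I 𝓘(ℝ).tangent ∞
      (fun y ↦ (⟨f y, mfderiv% f y (X y)⟩ : TangentBundle 𝓘(ℝ) ℝ)) x :=
    ContMDiffAt.clm_apply_of_inCoordinates (hf.mfderiv_const (m := ∞) (by simp)) hX hf
  exact (contMDiff_snd_tangentBundle_modelSpace ℝ 𝓘(ℝ)).contMDiffAt.comp x h

lemma SmoothFieldAt.oneForm {ϖ : Π x : M, TangentSpace I x →L[ℝ] ℝ} (hϖ : SmoothOneForm ϖ)
    {X : Π x : M, TangentSpace I x} {x : M} (hX : SmoothFieldAt X x) :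
    ContMDiffAt I 𝓘(ℝ) ∞ (fun y ↦ ϖ y (X y)) x := by
  have h := ContMDiffAt.clm_bundle_apply (hϖ x) hX
  rw [contMDiffAt_section] at h
  exact h

lemma _root_.MDifferentiableAt.oneForm {ϖ : Π x : M, TangentSpace I x →L[ℝ] ℝ}
    (hϖ : SmoothOneForm ϖ) {X : Π x : M, TangentSpace I x} {x : M} (hX : MDiffAt (T% X) x) :
    MDiffAt (fun y ↦ ϖ y (X y)) x := by
  have h := MDifferentiableAt.clm_bundle_apply ((hϖ x).mdifferentiableAt (by simp)) hX
  rw [mdifferentiableAt_section] at h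
  exact h

/-- The Lie bracket acts on functions as the commutator of directional derivatives. -/
lemma mvfderiv_mlieBracket {f : M → ℝ} {X Y : Π x : M, TangentSpace I x} {x : M}
    (hf : ContMDiffAt I 𝓘(ℝ) ∞ f x) (hX : SmoothFieldAt X x) (hY : SmoothFieldAt Y x) :
    d% f x (mlieBracket I X Y x) =
      d% (fun y ↦ d% f y (Y y)) x (X x) - d% (fun y ↦ d% f y (X y)) x (Y x) := by
  have : CompleteSpace E := FiniteDimensional.complete ℝ E
  have : IsManifold I (minSmoothness ℝ 3) M := by
    simp only [minSmoothness_of_isRCLikeNormedField]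
    infer_instance
  rcases subsingleton_or_nontrivial (TangentSpace I x) with _ | _
  · simp [Subsingleton.elim (X x) 0, Subsingleton.elim (Y x) 0,
      Subsingleton.elim (VectorField.mlieBracket I X Y x) 0]
  obtain ⟨w, hw0⟩ := exists_ne (0 : TangentSpace I x)
  refine sub_eq_zero.1 ((smul_eq_zero.1 ?_).resolve_right hw0)
  set W := FiberBundle.extend E w
  have hW : SmoothFieldAt W x := smoothFieldAt_extend w
  have key {U : Π x : M, TangentSpace I x} (hU : SmoothFieldAt U x) :
      VectorField.mlieBracket I U (f • W) =ᶠ[𝓝 x]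
        (fun y ↦ d% f y (U y)) • W + f • VectorField.mlieBracket I U W := by
    filter_upwards [hU.eventually_mdifferentiableAt, hW.eventually_mdifferentiableAt,
      eventually_mdifferentiableAt_of_contMDiffAt hf] with y hUy hWy hfy
    exact mlieBracket_smul_right hfy hWy
  have key' {U V : Π x : M, TangentSpace I x} (hU : SmoothFieldAt U x) (hV : SmoothFieldAt V x) :
      VectorField.mlieBracket I U (VectorField.mlieBracket I V (f • W)) x =
        d% (fun y ↦ d% f y (V y)) x (U x) • W x
        + d% f x (V x) • VectorField.mlieBracket I U W x
        + d% f x (U x) • VectorField.mlieBracket I V W x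
        + f x • VectorField.mlieBracket I U (VectorField.mlieBracket I V W) x := by
    have hVf := hV.mvfderiv hf
    have h := (EventuallyEq.refl (𝓝 x) U).mlieBracket_vectorField_eq (I := I) (key hV)
    rw [h,
      mlieBracket_add_right (hW.smul hVf).mdifferentiableAt
        ((hV.mlieBracket hW).smul hf).mdifferentiableAt,
      mlieBracket_smul_right (hVf.mdifferentiableAt (by simp)) hW.mdifferentiableAt,
      mlieBracket_smul_right (hf.mdifferentiableAt (by simp))
        (hV.mlieBracket hW).mdifferentiableAt]
    abel
  have h2 {U : Π x : M, TangentSpace I x} (hU : SmoothFieldAt U x) :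
      ContMDiffAt I I.tangent (minSmoothness ℝ 2) (fun y ↦ (U y : TangentBundle I M)) x := by
    simp only [minSmoothness_of_isRCLikeNormedField]
    exact ContMDiffAt.of_le hU ENat.LEInfty.out
  have jac := leibniz_identity_mlieBracket_apply (h2 hX) (h2 hY) (h2 (hW.smul hf))
  have jacW := leibniz_identity_mlieBracket_apply (h2 hX) (h2 hY) (h2 hW)
  rw [key' hX hY, key' hY hX, (key (hX.mlieBracket hY)).eq_of_nhds, jacW] at jac
  have hw : W x = w := FiberBundle.extend_apply_self ..
  simp only [Pi.add_apply, Pi.smul_apply', hw] at jac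
  linear_combination (norm := module) -jac

variable [RiemannianBundle (fun x : M ↦ TangentSpace I x)]
  [IsContMDiffRiemannianBundle I ∞ E
    (fun x : M ↦ TangentSpace I x)]

lemma SmoothFieldAt.metric {X Y : Π x : M, TangentSpace I x} {x : M}
    (hX : SmoothFieldAt X x) (hY : SmoothFieldAt Y x) :
    ContMDiffAt I 𝓘(ℝ) ∞ (metric I X Y) x :=
  ContMDiffAt.inner_bundle hX hY

lemma SmoothFieldAt.koszul {X Y Z : Π x : M, TangentSpace I x} {x : M}
    (hX : SmoothFieldAt X x) (hY : SmoothFieldAt Y x) (hZ : SmoothFieldAt Z x) :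
    ContMDiffAt I 𝓘(ℝ) ∞ (koszul I X Y Z) x := by
  unfold KahlerQS.koszul
  refine contMDiffAt_const.mul (((((hX.mvfderiv (hY.metric hZ)).add
    (hY.mvfderiv (hX.metric hZ))).sub (hZ.mvfderiv (hX.metric hY))).add
    ((hX.mlieBracket hY).metric hZ)).sub ((hX.mlieBracket hZ).metric hY) |>.sub
    ((hY.mlieBracket hZ).metric hX))

end Smoothness

section LeviCivitaSmooth

variable {E : Type*} [NormedAddCommGroup E] [NormedSpace ℝ E] [FiniteDimensional ℝ E]
  {H : Type*} [TopologicalSpace H] {I : ModelWithCorners ℝ E H}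
  {M : Type*} [TopologicalSpace M] [ChartedSpace H M] [IsManifold I ∞ M]

open Filter Topology

lemma contMDiffAt_matrix_det {ι : Type*} [Fintype ι] [DecidableEq ι] {G : M → Matrix ι ι ℝ} {x : M}
    (hG : ∀ i j, ContMDiffAt I 𝓘(ℝ) ∞ (fun y ↦ G y i j) x) :
    ContMDiffAt I 𝓘(ℝ) ∞ (fun y ↦ (G y).det) x := by
  simp only [Matrix.det_apply']
  exact contMDiffAt_finsetSum fun σ _ ↦ contMDiffAt_const.mul
    (contMDiffAt_finsetProd fun i _ ↦ hG _ _)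

variable [RiemannianBundle (fun x : M ↦ TangentSpace I x)]
  [IsContMDiffRiemannianBundle I ∞ E (fun x : M ↦ TangentSpace I x)]

/-- A vector field is smooth if its products with all smooth vector fields are. -/
lemma smoothFieldAt_of_metric {V : Π x : M, TangentSpace I x} {x : M}
    (h : ∀ W : Π x : M, TangentSpace I x, SmoothFieldAt W x →
      ContMDiffAt I 𝓘(ℝ) ∞ (metric I V W) x) : SmoothFieldAt V x := by
  let e := trivializationAt E (TangentSpace I) x
  have hx : x ∈ e.baseSet := FiberBundle.mem_baseSet_trivializationAt' x
  let b := finBasis ℝ E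
  have hs i : SmoothFieldAt (e.localFrame b i) x := contMDiffAt_localFrame_of_mem ∞ e b i hx
  refine (contMDiffAt_iff_localFrameCoeff b hx).2 fun i ↦ ?_
  let G : M → Matrix (Fin (finrank ℝ E)) (Fin (finrank ℝ E)) ℝ := fun y ↦
    Matrix.gram ℝ fun i ↦ e.localFrame b i y
  let k : M → Fin (finrank ℝ E) → ℝ := fun y j ↦ metric I V (e.localFrame b j) y
  have hdet : ∀ y ∈ e.baseSet, (G y).det ≠ 0 := fun y hy ↦ by
    have hli : LinearIndependent ℝ fun i ↦ e.localFrame b i y :=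
      (e.isLocalFrameOn_localFrame_baseSet I 1 b).linearIndependent hy
    exact (Matrix.posDef_gram_iff_linearIndependent.2 hli).det_pos.ne'
  have hcoeff : ∀ y ∈ e.baseSet, (LinearMap.piApply (e.localFrameCoeff I b i)) V y
      = ((G y).updateCol i (k y)).det * ((G y).det)⁻¹ := fun y hy ↦ by
    let c : Fin (finrank ℝ E) → ℝ := fun j ↦ e.localFrameCoeff I b j y (V y)
    have hk : (G y).mulVec c = k y := by
      ext j
      have hV := e.eq_sum_localFrameCoeff_smul (I := I) (b := b) (s := V) hy
      simp only [k, metric]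
      conv_rhs => rw [hV]
      simp [G, c, Matrix.mulVec, dotProduct, Matrix.gram_apply, sum_inner, inner_smul_left,
        mul_comm, real_inner_comm]
    have hc : (G y).det • c = (G y).cramer (k y) := by
      rw [Matrix.cramer_eq_adjugate_mulVec, ← hk, Matrix.mulVec_mulVec, Matrix.adjugate_mul,
        Matrix.smul_mulVec, Matrix.one_mulVec]
    rw [← Matrix.cramer_apply, ← hc]
    simp only [Pi.smul_apply, smul_eq_mul]
    field_simp [hdet y hy]
    rfl
  refine ContMDiffAt.congr_of_eventuallyEq ?_
    (eventually_of_mem (e.open_baseSet.mem_nhds hx) hcoeff)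
  have hG i j : ContMDiffAt I 𝓘(ℝ) ∞ (fun y ↦ G y i j) x := (hs i).metric (hs j)
  refine (contMDiffAt_matrix_det fun j l ↦ ?_).mul
    ((contMDiffAt_matrix_det hG).inv₀ (hdet x hx))
  simp only [Matrix.updateCol_apply]
  split_ifs
  · exact h _ (hs j)
  · exact hG j l

/-- The field `∇_X Y` of the Levi-Civita connection. -/
abbrev lcNabla (X Y : Π x : M, TangentSpace I x) : Π x : M, TangentSpace I x :=
  nabla (leviCivita I M) X Y

lemma SmoothFieldAt.lcNabla {X Y : Π x : M, TangentSpace I x} {x : M}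
    (hX : SmoothFieldAt X x) (hY : SmoothFieldAt Y x) : SmoothFieldAt (lcNabla X Y) x := by
  refine smoothFieldAt_of_metric fun W hW ↦ ?_
  refine (hX.koszul hY hW).congr_of_eventuallyEq ?_
  filter_upwards [hX.eventually_mdifferentiableAt, hY.eventually_mdifferentiableAt,
    hW.eventually_mdifferentiableAt] with y h1 h2 h3
  exact inner_leviCivitaFun_eq_koszul I h1 h2 h3

lemma lcNabla_congr {X Y Y' : Π x : M, TangentSpace I x} {x : M} (hY : SmoothFieldAt Y x)
    (h : Y' =ᶠ[𝓝 x] Y) : lcNabla X Y' x = lcNabla X Y x :=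
  congrArg (fun T : TangentSpace I x →L[ℝ] TangentSpace I x ↦ T (X x))
    ((leviCivita I M).isCovariantDerivativeOnUniv.congr_of_eventuallyEq
      (hY.congr h).mdifferentiableAt hY.mdifferentiableAt univ_mem h)

lemma lcNabla_add {X Y Y' : Π x : M, TangentSpace I x} {x : M} (hY : SmoothFieldAt Y x)
    (hY' : SmoothFieldAt Y' x) : lcNabla X (Y + Y') x = lcNabla X Y x + lcNabla X Y' x := by
  simp [nabla, (leviCivita I M).isCovariantDerivativeOnUniv.add hY.mdifferentiableAt
    hY'.mdifferentiableAt]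

lemma lcNabla_smul {X Y : Π x : M, TangentSpace I x} {f : M → ℝ} {x : M}
    (hY : SmoothFieldAt Y x) (hf : ContMDiffAt I 𝓘(ℝ) ∞ f x) :
    lcNabla X (f • Y) x = f x • lcNabla X Y x + d% f x (X x) • Y x := by
  simp [nabla, (leviCivita I M).isCovariantDerivativeOnUniv.leibniz hY.mdifferentiableAt
    (hf.mdifferentiableAt (by simp))]

lemma lcNabla_const_smul {X Y : Π x : M, TangentSpace I x} (a : ℝ) {x : M}
    (hY : SmoothFieldAt Y x) : lcNabla X (a • Y) x = a • lcNabla X Y x := by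
  simp [nabla, (leviCivita I M).isCovariantDerivativeOnUniv.smul_const a hY.mdifferentiableAt]

lemma lcNabla_sub {X Y Y' : Π x : M, TangentSpace I x} {x : M} (hY : SmoothFieldAt Y x)
    (hY' : SmoothFieldAt Y' x) : lcNabla X (Y - Y') x = lcNabla X Y x - lcNabla X Y' x := by
  have h : Y - Y' = Y + (-1 : ℝ) • Y' := by module
  rw [h, lcNabla_add hY (hY'.const_smul _), lcNabla_const_smul _ hY']
  module

lemma lcNabla_torsion {X Y : Π x : M, TangentSpace I x} {x : M} (hX : MDiffAt (T% X) x)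
    (hY : MDiffAt (T% Y) x) : mlieBracket I X Y x = lcNabla X Y x - lcNabla Y X x :=
  ((CovariantDerivative.torsion_eq_zero_iff _).1 (leviCivita_torsion I (M := M)) hX hY).symm

lemma lcNabla_metric {X Y Z : Π x : M, TangentSpace I x} {x : M} (hX : MDiffAt (T% X) x)
    (hY : MDiffAt (T% Y) x) (hZ : MDiffAt (T% Z) x) :
    d% (metric I Y Z) x (X x) = metric I (lcNabla X Y) Z x + metric I Y (lcNabla X Z) x :=
  leviCivita_metric I hX hY hZ

end LeviCivitaSmooth

section RiemannTensor

variable {E : Type*} [NormedAddCommGroup E] [NormedSpace ℝ E] [FiniteDimensional ℝ E]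
  {H : Type*} [TopologicalSpace H] {I : ModelWithCorners ℝ E H}
  {M : Type*} [TopologicalSpace M] [ChartedSpace H M] [IsManifold I ∞ M]

open Filter Topology

lemma mvfderiv_congr {f g : M → ℝ} {x : M} (h : f =ᶠ[𝓝 x] g) : d% f x = d% g x := by
  ext v
  change mfderiv I 𝓘(ℝ) f x v = mfderiv I 𝓘(ℝ) g x v
  rw [h.mfderiv_eq]
  rfl

variable [RiemannianBundle (fun x : M ↦ TangentSpace I x)]
  [IsContMDiffRiemannianBundle I ∞ E (fun x : M ↦ TangentSpace I x)]

variable {X Y Z W : Π x : M, TangentSpace I x} {x : M}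

lemma riemann_eq : riemann I X Y Z x = lcNabla X (lcNabla Y Z) x - lcNabla Y (lcNabla X Z) x
    - lcNabla (mlieBracket I X Y) Z x := rfl

lemma lcNabla_mlieBracket (hX : SmoothFieldAt X x) (hY : SmoothFieldAt Y x) :
    lcNabla (mlieBracket I X Y) Z x = lcNabla (lcNabla X Y) Z x - lcNabla (lcNabla Y X) Z x := by
  simp only [lcNabla, nabla, ← map_sub]
  congr 1
  exact lcNabla_torsion hX.mdifferentiableAt hY.mdifferentiableAt

lemma riemann_swap : riemann I X Y Z x = -riemann I Y X Z x := by
  have h : lcNabla (mlieBracket I X Y) Z x = -lcNabla (mlieBracket I Y X) Z x := by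
    simp only [lcNabla, nabla, ← map_neg]
    congr 1
    exact mlieBracket_swap_apply
  rw [riemann_eq, riemann_eq, h]
  abel

lemma mvfderiv_mvfderiv_metric (hX : SmoothFieldAt X x) (hY : SmoothFieldAt Y x)
    (hZ : SmoothFieldAt Z x) (hW : SmoothFieldAt W x) :
    d% (fun y ↦ d% (metric I Z W) y (Y y)) x (X x) =
      metric I (lcNabla X (lcNabla Y Z)) W x + metric I (lcNabla Y Z) (lcNabla X W) x
      + (metric I (lcNabla X Z) (lcNabla Y W) x + metric I Z (lcNabla X (lcNabla Y W)) x) := by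
  have h : (fun y ↦ d% (metric I Z W) y (Y y)) =ᶠ[𝓝 x]
      fun y ↦ metric I (lcNabla Y Z) W y + metric I Z (lcNabla Y W) y := by
    filter_upwards [hY.eventually_mdifferentiableAt, hZ.eventually_mdifferentiableAt,
      hW.eventually_mdifferentiableAt] with y h1 h2 h3
    exact lcNabla_metric h1 h2 h3
  rw [mvfderiv_congr h, mvfderiv_fun_add
    (metric_mdifferentiableAt I (hY.lcNabla hZ).mdifferentiableAt hW.mdifferentiableAt)
    (metric_mdifferentiableAt I hZ.mdifferentiableAt (hY.lcNabla hW).mdifferentiableAt),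
    add_apply,
    lcNabla_metric hX.mdifferentiableAt (hY.lcNabla hZ).mdifferentiableAt hW.mdifferentiableAt,
    lcNabla_metric hX.mdifferentiableAt hZ.mdifferentiableAt (hY.lcNabla hW).mdifferentiableAt]

/-- `R(X,Y)` is skew-adjoint. -/
lemma riemann_skew (hX : SmoothFieldAt X x) (hY : SmoothFieldAt Y x)
    (hZ : SmoothFieldAt Z x) (hW : SmoothFieldAt W x) :
    inner ℝ (riemann I X Y Z x) (W x) = -inner ℝ (riemann I X Y W x) (Z x) := by
  have h := mvfderiv_mlieBracket (hZ.metric hW) hX hY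
  rw [mvfderiv_mvfderiv_metric hX hY hZ hW, mvfderiv_mvfderiv_metric hY hX hZ hW,
    lcNabla_metric (hX.mlieBracket hY).mdifferentiableAt hZ.mdifferentiableAt
      hW.mdifferentiableAt] at h
  simp only [metric] at h
  simp only [riemann_eq, inner_sub_left]
  rw [real_inner_comm (lcNabla X (lcNabla Y W) x), real_inner_comm (lcNabla Y (lcNabla X W) x),
    real_inner_comm (lcNabla (mlieBracket I X Y) W x)] at h
  linarith

/-- The first Bianchi identity. -/
lemma riemann_bianchi (hX : SmoothFieldAt X x) (hY : SmoothFieldAt Y x)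
    (hZ : SmoothFieldAt Z x) :
    riemann I X Y Z x + riemann I Y Z X x + riemann I Z X Y x = 0 := by
  have key {U V W : Π x : M, TangentSpace I x} (hU : SmoothFieldAt U x) (hV : SmoothFieldAt V x)
      (hW : SmoothFieldAt W x) : lcNabla U (lcNabla V W) x - lcNabla U (lcNabla W V) x
        - lcNabla (mlieBracket I V W) U x = mlieBracket I U (mlieBracket I V W) x := by
    have h : mlieBracket I V W =ᶠ[𝓝 x] lcNabla V W - lcNabla W V := by
      filter_upwards [hV.eventually_mdifferentiableAt, hW.eventually_mdifferentiableAt]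
        with y h1 h2
      exact lcNabla_torsion h1 h2
    rw [lcNabla_torsion hU.mdifferentiableAt (hV.mlieBracket hW).mdifferentiableAt,
      lcNabla_congr ((hV.lcNabla hW).sub (hW.lcNabla hV)) h,
      lcNabla_sub (hV.lcNabla hW) (hW.lcNabla hV)]
  have : CompleteSpace E := FiniteDimensional.complete ℝ E
  have : IsManifold I (minSmoothness ℝ 3) M := by
    simp only [minSmoothness_of_isRCLikeNormedField]
    infer_instance
  have h2 {U : Π x : M, TangentSpace I x} (hU : SmoothFieldAt U x) :
      ContMDiffAt I I.tangent (minSmoothness ℝ 2) (fun y ↦ (U y : TangentBundle I M)) x := by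
    simp only [minSmoothness_of_isRCLikeNormedField]
    exact ContMDiffAt.of_le hU ENat.LEInfty.out
  have jac := leibniz_identity_mlieBracket_apply (h2 hX) (h2 hY) (h2 hZ)
  have h3 : mlieBracket I Y (mlieBracket I X Z) x = -mlieBracket I Y (mlieBracket I Z X) x := by
    rw [mlieBracket_swap (V := X), ← neg_one_smul ℝ (mlieBracket I Z X),
      mlieBracket_const_smul_right (hZ.mlieBracket hX).mdifferentiableAt, neg_one_smul]
  rw [mlieBracket_swap_apply (V := mlieBracket I X Y), h3, ← key hX hY hZ, ← key hZ hX hY,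
    ← key hY hZ hX] at jac
  simp only [riemann_eq]
  linear_combination (norm := module) jac

/-- The pair symmetry of the curvature tensor. -/
lemma riemann_pair_symm (hX : SmoothFieldAt X x) (hY : SmoothFieldAt Y x)
    (hZ : SmoothFieldAt Z x) (hW : SmoothFieldAt W x) :
    inner ℝ (riemann I X Y Z x) (W x) = inner ℝ (riemann I Z W X x) (Y x) := by
  have bianchi {A B C D : Π x : M, TangentSpace I x} (hA : SmoothFieldAt A x)
      (hB : SmoothFieldAt B x) (hC : SmoothFieldAt C x) :
      inner ℝ (riemann I A B C x) (D x) + inner ℝ (riemann I B C A x) (D x)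
        + inner ℝ (riemann I C A B x) (D x) = 0 := by
    rw [← inner_add_left, ← inner_add_left, riemann_bianchi hA hB hC, inner_zero_left]
  have swap (A B C D : Π x : M, TangentSpace I x) :
      inner ℝ (riemann I A B C x) (D x) = -inner ℝ (riemann I B A C x) (D x) := by
    rw [riemann_swap, inner_neg_left]
  have b1 := bianchi (D := W) hX hY hZ
  have b2 := bianchi (D := X) hY hZ hW
  have b3 := bianchi (D := Y) hZ hW hX
  have b4 := bianchi (D := Z) hW hX hY
  have s1 := riemann_skew hX hY hZ hW
  have s2 := riemann_skew hY hZ hX hW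
  have s3 := riemann_skew hZ hX hY hW
  have s4 := riemann_skew hZ hW hX hY
  have s5 := riemann_skew hX hW hY hZ
  have s6 := riemann_skew hY hW hX hZ
  have t1 := swap Z X Y W
  have t2 := swap W X Y Z
  have t3 := swap W X Z Y
  have t4 := swap W Y Z X
  have t5 := swap Y W Z X
  have t6 := swap Y W X Z
  have t7 := swap X Z W Y
  linarith

lemma riemann_comb_right (hX : SmoothFieldAt X x) (hY : SmoothFieldAt Y x)
    {Z₁ Z₂ : Π x : M, TangentSpace I x} (hZ : SmoothFieldAt Z x) (hZ₁ : SmoothFieldAt Z₁ x)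
    (hZ₂ : SmoothFieldAt Z₂ x) {a b : ℝ} (h : Z x = a • Z₁ x + b • Z₂ x) :
    riemann I X Y Z x = a • riemann I X Y Z₁ x + b • riemann I X Y Z₂ x := by
  refine ext_inner_right ℝ fun w ↦ ?_
  have hw : FiberBundle.extend E w x = w := FiberBundle.extend_apply_self ..
  have hW := smoothFieldAt_extend (I := I) w
  rw [← hw, riemann_skew hX hY hZ hW, h, inner_add_left, inner_smul_left, inner_smul_left,
    riemann_skew hX hY hZ₁ hW, riemann_skew hX hY hZ₂ hW, inner_add_right, inner_smul_right,
    inner_smul_right]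
  simp
  ring

lemma riemann_comb_middle (hX : SmoothFieldAt X x) {Y₁ Y₂ : Π x : M, TangentSpace I x}
    (hY : SmoothFieldAt Y x) (hY₁ : SmoothFieldAt Y₁ x) (hY₂ : SmoothFieldAt Y₂ x)
    (hZ : SmoothFieldAt Z x) {a b : ℝ} (h : Y x = a • Y₁ x + b • Y₂ x) :
    riemann I X Y Z x = a • riemann I X Y₁ Z x + b • riemann I X Y₂ Z x := by
  refine ext_inner_right ℝ fun w ↦ ?_
  have hw : FiberBundle.extend E w x = w := FiberBundle.extend_apply_self ..
  have hW := smoothFieldAt_extend (I := I) w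
  rw [← hw, riemann_pair_symm hX hY hZ hW, h, inner_add_left, inner_smul_left, inner_smul_left,
    riemann_pair_symm hX hY₁ hZ hW, riemann_pair_symm hX hY₂ hZ hW, inner_add_right,
    inner_smul_right, inner_smul_right]
  simp

lemma riemann_comb_left {X₁ X₂ : Π x : M, TangentSpace I x}
    (hX : SmoothFieldAt X x) (hX₁ : SmoothFieldAt X₁ x) (hX₂ : SmoothFieldAt X₂ x)
    (hY : SmoothFieldAt Y x) (hZ : SmoothFieldAt Z x) {a b : ℝ}
    (h : X x = a • X₁ x + b • X₂ x) :
    riemann I X Y Z x = a • riemann I X₁ Y Z x + b • riemann I X₂ Y Z x := by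
  rw [riemann_swap, riemann_comb_middle hY hX hX₁ hX₂ hZ h, riemann_swap (X := X₁),
    riemann_swap (X := X₂)]
  module

variable (I) in
/-- The value at `x` of the Riemann curvature tensor, as a trilinear map. -/
def riemannAt (x : M) : TangentSpace I x →ₗ[ℝ] TangentSpace I x →ₗ[ℝ] TangentSpace I x →ₗ[ℝ]
    TangentSpace I x :=
  let e (v : TangentSpace I x) : Π y : M, TangentSpace I y := FiberBundle.extend E v
  have he (v : TangentSpace I x) : SmoothFieldAt (e v) x := smoothFieldAt_extend v
  have hx (v : TangentSpace I x) : e v x = v := FiberBundle.extend_apply_self ..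
  { toFun u := LinearMap.mk₂ ℝ (fun v w ↦ riemann I (e u) (e v) (e w) x)
      (fun v v' w ↦ by
        simpa using riemann_comb_middle (he u) (he (v + v')) (he v) (he v') (he w)
          (a := 1) (b := 1) (by simp [hx]))
      (fun a v w ↦ by
        simpa using riemann_comb_middle (he u) (he (a • v)) (he v) (he v) (he w)
          (a := a) (b := 0) (by simp [hx]))
      (fun v w w' ↦ by
        simpa using riemann_comb_right (he u) (he v) (he (w + w')) (he w) (he w')
          (a := 1) (b := 1) (by simp [hx]))
      (fun a v w ↦ by
        simpa using riemann_comb_right (he u) (he v) (he (a • w)) (he w) (he w)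
          (a := a) (b := 0) (by simp [hx]))
    map_add' u u' := LinearMap.ext₂ fun v w ↦ by
      simpa using riemann_comb_left (he (u + u')) (he u) (he u') (he v) (he w)
        (a := 1) (b := 1) (by simp [hx])
    map_smul' a u := LinearMap.ext₂ fun v w ↦ by
      simpa using riemann_comb_left (he (a • u)) (he u) (he u) (he v) (he w)
        (a := a) (b := 0) (by simp [hx]) }

lemma riemann_eq_riemannAt (hX : SmoothFieldAt X x) (hY : SmoothFieldAt Y x)
    (hZ : SmoothFieldAt Z x) : riemann I X Y Z x = riemannAt I x (X x) (Y x) (Z x) := by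
  have he (v : TangentSpace I x) := smoothFieldAt_extend (I := I) v
  change _ = riemann I (FiberBundle.extend E (X x)) (FiberBundle.extend E (Y x))
    (FiberBundle.extend E (Z x)) x
  rw [riemann_comb_left hX (he (X x)) (he (X x)) hY hZ (a := 1) (b := 0) (by simp),
    riemann_comb_middle (he (X x)) hY (he (Y x)) (he (Y x)) hZ (a := 1) (b := 0) (by simp),
    riemann_comb_right (he (X x)) (he (Y x)) hZ (he (Z x)) (he (Z x)) (a := 1) (b := 0)
      (by simp)]
  simp

section Pointwise

variable (u v w z : TangentSpace I x)

lemma riemannAt_eq : riemannAt I x u v w = riemann I (FiberBundle.extend E u)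
    (FiberBundle.extend E v) (FiberBundle.extend E w) x := rfl

lemma riemannAt_skew : inner ℝ (riemannAt I x u v w) z = -inner ℝ (riemannAt I x u v z) w := by
  simpa [riemannAt_eq] using riemann_skew (smoothFieldAt_extend u) (smoothFieldAt_extend v)
    (smoothFieldAt_extend w) (smoothFieldAt_extend z)

lemma riemannAt_swap : riemannAt I x u v w = -riemannAt I x v u w := riemann_swap

lemma riemannAt_pair_symm :
    inner ℝ (riemannAt I x u v w) z = inner ℝ (riemannAt I x w z u) v := by
  simpa [riemannAt_eq] using riemann_pair_symm (smoothFieldAt_extend u) (smoothFieldAt_extend v)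
    (smoothFieldAt_extend w) (smoothFieldAt_extend z)

end Pointwise

end RiemannTensor

section QuarterSymmetric

variable {E : Type*} [NormedAddCommGroup E] [NormedSpace ℝ E] [FiniteDimensional ℝ E]
  {H : Type*} [TopologicalSpace H] {I : ModelWithCorners ℝ E H}
  {M : Type*} [TopologicalSpace M] [ChartedSpace H M] [IsManifold I ∞ M]
  [RiemannianBundle (fun x : M ↦ TangentSpace I x)]
  [IsContMDiffRiemannianBundle I ∞ E (fun x : M ↦ TangentSpace I x)]

open Filter Topology

variable {X Y Z : Π x : M, TangentSpace I x} {x : M}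
  {A : Π x : M, TangentSpace I x →L[ℝ] TangentSpace I x}
  {ϖ : Π x : M, TangentSpace I x →L[ℝ] ℝ}

lemma SmoothFieldAt.app (hX : SmoothFieldAt X x) (hA : IsKahler A) :
    SmoothFieldAt (app A X) x :=
  ContMDiffAt.clm_bundle_apply (hA.smooth x) hX

lemma lcNabla_app (hA : IsKahler A) (hY : MDiffAt (T% Y) x) :
    lcNabla X (app A Y) x = A x (lcNabla X Y x) := hA.parallel Y x hY _

lemma riemann_app (hA : IsKahler A) (hX : SmoothFieldAt X x) (hY : SmoothFieldAt Y x)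
    (hZ : SmoothFieldAt Z x) : riemann I X Y (app A Z) x = A x (riemann I X Y Z x) := by
  have key {U V : Π x : M, TangentSpace I x} (hU : SmoothFieldAt U x) (hV : SmoothFieldAt V x) :
      lcNabla U (lcNabla V (app A Z)) x = A x (lcNabla U (lcNabla V Z) x) := by
    have h : lcNabla V (app A Z) =ᶠ[𝓝 x] app A (lcNabla V Z) := by
      filter_upwards [hZ.eventually_mdifferentiableAt] with y hy
      exact lcNabla_app hA hy
    rw [lcNabla_congr ((hV.lcNabla hZ).app hA) h, lcNabla_app hA (hV.lcNabla hZ).mdifferentiableAt]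
  rw [riemann_eq, riemann_eq, key hX hY, key hY hX, lcNabla_app hA hZ.mdifferentiableAt, map_sub,
    map_sub]

lemma riemannAt_app (hA : IsKahler A) (u v w : TangentSpace I x) :
    riemannAt I x u v (A x w) = A x (riemannAt I x u v w) := by
  have hu := smoothFieldAt_extend (I := I) u
  have hv := smoothFieldAt_extend (I := I) v
  have hw := smoothFieldAt_extend (I := I) w
  have h := riemann_app hA hu hv hw
  rw [riemann_eq_riemannAt hu hv (hw.app hA), riemann_eq_riemannAt hu hv hw] at h
  simpa [app] using h

/-- The covariant derivative `(∇_X ϖ)(Y)` of a 1-form. -/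
def formDeriv (ϖ : Π x : M, TangentSpace I x →L[ℝ] ℝ) (X Y : Π x : M, TangentSpace I x)
    (x : M) : ℝ :=
  d% (fun y ↦ ϖ y (Y y)) x (X x) - ϖ x (lcNabla X Y x)

lemma formDeriv_tensorial_right (hϖ : SmoothOneForm ϖ) (X : Π x : M, TangentSpace I x) (x : M) :
    TensorialAt I E (fun Y ↦ formDeriv ϖ X Y x) x where
  smul {f Y} hf hY := by
    have h : (fun y ↦ ϖ y ((f • Y) y)) = fun y ↦ f y * ϖ y (Y y) := by ext; simp
    simp only [formDeriv, nabla, h, mvfderiv_fun_mul hf (MDifferentiableAt.oneForm hϖ hY),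
      (leviCivita I M).isCovariantDerivativeOnUniv.leibniz hY hf]
    simp
    ring
  add {Y Y'} hY hY' := by
    have h : (fun y ↦ ϖ y ((Y + Y') y)) = fun y ↦ ϖ y (Y y) + ϖ y (Y' y) := by ext; simp
    simp only [formDeriv, nabla, h, mvfderiv_fun_add (MDifferentiableAt.oneForm hϖ hY)
        (MDifferentiableAt.oneForm hϖ hY'),
      (leviCivita I M).isCovariantDerivativeOnUniv.add hY hY']
    simp
    ring

lemma formDeriv_tensorial_left (ϖ : Π x : M, TangentSpace I x →L[ℝ] ℝ)
    (Y : Π x : M, TangentSpace I x) (x : M) :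
    TensorialAt I E (fun X ↦ formDeriv ϖ X Y x) x where
  smul {f X} _ _ := by
    simp [formDeriv, nabla]
    ring
  add {X X'} _ _ := by
    simp [formDeriv, nabla]
    ring

/-- The value at `x` of the covariant derivative of a 1-form, as a bilinear form. -/
def formDerivAt (hϖ : SmoothOneForm ϖ) (x : M) :
    TangentSpace I x →L[ℝ] TangentSpace I x →L[ℝ] ℝ :=
  TensorialAt.mkHom₂ (I := I) (F := E) (F' := E) (fun X Y ↦ formDeriv ϖ X Y x) x
    (fun Y _ ↦ formDeriv_tensorial_left ϖ Y x) (fun X _ ↦ formDeriv_tensorial_right hϖ X x)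

lemma formDerivAt_apply (hϖ : SmoothOneForm ϖ) (hX : SmoothFieldAt X x) (hY : SmoothFieldAt Y x) :
    formDerivAt hϖ x (X x) (Y x) = formDeriv ϖ X Y x :=
  TensorialAt.mkHom₂_apply _ _ hX.mdifferentiableAt hY.mdifferentiableAt

/-- The operator `∇_X Y - a ϖ(X) A Y - b ϖ(Y) A X`. For `(a, b) = (1, 0), (0, 1), (1/2, 1/2)` it is
the quarter-symmetric connection, its conjugate and its symmetric part. -/
def twistedNabla (A : Π x : M, TangentSpace I x →L[ℝ] TangentSpace I x)
    (ϖ : Π x : M, TangentSpace I x →L[ℝ] ℝ) (a b : ℝ) (X Y : Π x : M, TangentSpace I x) :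
    Π x : M, TangentSpace I x :=
  lcNabla X Y - a • ((fun y ↦ ϖ y (X y)) • app A Y) - b • ((fun y ↦ ϖ y (Y y)) • app A X)

lemma twistedNabla_apply (a b : ℝ) : twistedNabla A ϖ a b X Y x =
    lcNabla X Y x - (a * ϖ x (X x)) • A x (Y x) - (b * ϖ x (Y x)) • A x (X x) := by
  simp [twistedNabla, app, smul_smul]

lemma SmoothFieldAt.twistedNabla (hX : SmoothFieldAt X x) (hY : SmoothFieldAt Y x)
    (hA : IsKahler A) (hϖ : SmoothOneForm ϖ) (a b : ℝ) :
    SmoothFieldAt (twistedNabla A ϖ a b X Y) x :=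
  ((hX.lcNabla hY).sub (((hY.app hA).smul (hX.oneForm hϖ)).const_smul a)).sub
    (((hX.app hA).smul (hY.oneForm hϖ)).const_smul b)

lemma twistedNabla_congr (hY : SmoothFieldAt Y x) {Y' : Π x : M, TangentSpace I x} {a b : ℝ}
    (h : Y' =ᶠ[𝓝 x] Y) : twistedNabla A ϖ a b X Y' x = twistedNabla A ϖ a b X Y x := by
  rw [twistedNabla_apply, twistedNabla_apply, lcNabla_congr hY h, h.eq_of_nhds]

lemma twistedNabla_left_congr {X' : Π x : M, TangentSpace I x} {a b : ℝ}
    (h : X' x = X x) : twistedNabla A ϖ a b X' Y x = twistedNabla A ϖ a b X Y x := by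
  simp only [twistedNabla_apply, h, nabla]

lemma lcNabla_form_smul_app (hA : IsKahler A) (hϖ : SmoothOneForm ϖ)
    (hX : SmoothFieldAt X x) (hY : SmoothFieldAt Y x) (hZ : SmoothFieldAt Z x) :
    lcNabla X ((fun y ↦ ϖ y (Y y)) • app A Z) x = ϖ x (Y x) • A x (lcNabla X Z x)
      + (formDerivAt hϖ x (X x) (Y x) + ϖ x (lcNabla X Y x)) • A x (Z x) := by
  rw [lcNabla_smul (hZ.app hA) (hY.oneForm hϖ), lcNabla_app hA hZ.mdifferentiableAt,
    formDerivAt_apply hϖ hX hY, formDeriv, sub_add_cancel]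
  rfl

lemma twistedNabla_twistedNabla (hA : IsKahler A) (hϖ : SmoothOneForm ϖ)
    (hX : SmoothFieldAt X x) (hY : SmoothFieldAt Y x) (hZ : SmoothFieldAt Z x) (a b c d : ℝ) :
    twistedNabla A ϖ a b X (twistedNabla A ϖ c d Y Z) x =
      lcNabla X (lcNabla Y Z) x
      - c • (ϖ x (Y x) • A x (lcNabla X Z x)
        + (formDerivAt hϖ x (X x) (Y x) + ϖ x (lcNabla X Y x)) • A x (Z x))
      - d • (ϖ x (Z x) • A x (lcNabla X Y x)
        + (formDerivAt hϖ x (X x) (Z x) + ϖ x (lcNabla X Z x)) • A x (Y x))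
      - (a * ϖ x (X x)) • (A x (lcNabla Y Z x) + (c * ϖ x (Y x)) • Z x + (d * ϖ x (Z x)) • Y x)
      - (b * (ϖ x (lcNabla Y Z x) - c * ϖ x (Y x) * ϖ x (A x (Z x))
        - d * ϖ x (Z x) * ϖ x (A x (Y x)))) • A x (X x) := by
  have h1 := (hZ.app hA).smul (hY.oneForm hϖ)
  have h2 := (hY.app hA).smul (hZ.oneForm hϖ)
  rw [twistedNabla_apply, twistedNabla_apply, twistedNabla,
    lcNabla_sub ((hY.lcNabla hZ).sub (h1.const_smul c)) (h2.const_smul d),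
    lcNabla_sub (hY.lcNabla hZ) (h1.const_smul c), lcNabla_const_smul c h1,
    lcNabla_const_smul d h2, lcNabla_form_smul_app hA hϖ hX hY hZ,
    lcNabla_form_smul_app hA hϖ hX hZ hY]
  simp only [map_sub, map_smul, hA.sq, smul_eq_mul]
  module

lemma nabla_quarterSymmetric :
    nabla (quarterSymmetric A ϖ) X Y = twistedNabla A ϖ 1 0 X Y := by
  ext1 x
  rw [twistedNabla_apply]
  simp [nabla, quarterSymmetric]

lemma conjNabla_quarterSymmetric (hX : SmoothFieldAt X x) (hY : SmoothFieldAt Y x) :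
    conjNabla (quarterSymmetric A ϖ) X Y =ᶠ[𝓝 x] twistedNabla A ϖ 0 1 X Y := by
  filter_upwards [hX.eventually_mdifferentiableAt, hY.eventually_mdifferentiableAt] with y h1 h2
  change nabla (quarterSymmetric A ϖ) Y X y + mlieBracket I X Y y = _
  rw [nabla_quarterSymmetric, twistedNabla_apply, twistedNabla_apply, lcNabla_torsion h1 h2]
  module

lemma symNabla_quarterSymmetric (hX : SmoothFieldAt X x) (hY : SmoothFieldAt Y x) :
    symNabla (quarterSymmetric A ϖ) X Y =ᶠ[𝓝 x] twistedNabla A ϖ (1 / 2) (1 / 2) X Y := by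
  filter_upwards [conjNabla_quarterSymmetric (A := A) (ϖ := ϖ) hX hY] with y hy
  change (1 / 2 : ℝ) • (nabla (quarterSymmetric A ϖ) X Y y
    + conjNabla (quarterSymmetric A ϖ) X Y y) = _
  rw [hy, nabla_quarterSymmetric, twistedNabla_apply, twistedNabla_apply, twistedNabla_apply]
  module

lemma curvature1_quarterSymmetric (hA : IsKahler A) (hϖ : SmoothOneForm ϖ)
    (hX : SmoothFieldAt X x) (hY : SmoothFieldAt Y x) (hZ : SmoothFieldAt Z x) :
    curvature1 (quarterSymmetric A ϖ) X Y Z x = riemannAt I x (X x) (Y x) (Z x)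
      - (formDerivAt hϖ x (X x) (Y x) - formDerivAt hϖ x (Y x) (X x)) • A x (Z x) := by
  rw [← riemann_eq_riemannAt hX hY hZ, riemann_eq]
  simp only [curvature1, curvatureOp, Pi.sub_apply, nabla_quarterSymmetric]
  rw [twistedNabla_twistedNabla hA hϖ hX hY hZ, twistedNabla_twistedNabla hA hϖ hY hX hZ,
    twistedNabla_apply, lcNabla_torsion hX.mdifferentiableAt hY.mdifferentiableAt]
  simp only [map_sub]
  module

lemma curvature0_quarterSymmetric (hA : IsKahler A) (hϖ : SmoothOneForm ϖ)
    (hX : SmoothFieldAt X x) (hY : SmoothFieldAt Y x) (hZ : SmoothFieldAt Z x) :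
    curvature0 (quarterSymmetric A ϖ) X Y Z x = riemannAt I x (X x) (Y x) (Z x)
      - (1 / 2 : ℝ) • ((formDerivAt hϖ x (X x) (Y x) - formDerivAt hϖ x (Y x) (X x)) • A x (Z x)
        + formDerivAt hϖ x (X x) (Z x) • A x (Y x) - formDerivAt hϖ x (Y x) (Z x) • A x (X x))
      - (1 / 4 : ℝ) • ((ϖ x (X x) * ϖ x (Z x)) • Y x - (ϖ x (Y x) * ϖ x (Z x)) • X x)
      + (1 / 4 : ℝ) • ((ϖ x (Y x) * ϖ x (A x (Z x)) + ϖ x (Z x) * ϖ x (A x (Y x))) • A x (X x)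
        - (ϖ x (X x) * ϖ x (A x (Z x)) + ϖ x (Z x) * ϖ x (A x (X x))) • A x (Y x)) := by
  have key {U V : Π x : M, TangentSpace I x} (hU : SmoothFieldAt U x) (hV : SmoothFieldAt V x) :
      symNabla (quarterSymmetric A ϖ) U (symNabla (quarterSymmetric A ϖ) V Z) x =
        twistedNabla A ϖ (1 / 2) (1 / 2) U (twistedNabla A ϖ (1 / 2) (1 / 2) V Z) x := by
    have h := symNabla_quarterSymmetric (A := A) (ϖ := ϖ) hV hZ
    have hs := hV.twistedNabla hZ hA hϖ (1 / 2) (1 / 2)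
    rw [(symNabla_quarterSymmetric hU (hs.congr h)).eq_of_nhds, twistedNabla_congr hs h]
  rw [← riemann_eq_riemannAt hX hY hZ, riemann_eq]
  simp only [curvature0, curvatureOp, Pi.sub_apply]
  rw [key hX hY, key hY hX, (symNabla_quarterSymmetric (hX.mlieBracket hY) hZ).eq_of_nhds,
    twistedNabla_twistedNabla hA hϖ hX hY hZ, twistedNabla_twistedNabla hA hϖ hY hX hZ,
    twistedNabla_apply, lcNabla_torsion hX.mdifferentiableAt hY.mdifferentiableAt]
  simp only [map_sub]
  module

lemma curvature3_quarterSymmetric (hA : IsKahler A) (hϖ : SmoothOneForm ϖ)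
    (hX : SmoothFieldAt X x) (hY : SmoothFieldAt Y x) (hZ : SmoothFieldAt Z x) :
    curvature3 (quarterSymmetric A ϖ) X Y Z x = riemannAt I x (X x) (Y x) (Z x)
      - formDerivAt hϖ x (X x) (Y x) • A x (Z x) + formDerivAt hϖ x (Y x) (Z x) • A x (X x)
      + ϖ x (Y x) • (ϖ x (A x (Z x)) • A x (X x) - ϖ x (A x (X x)) • A x (Z x)) := by
  have hXZ := conjNabla_quarterSymmetric (A := A) (ϖ := ϖ) hX hZ
  have hXY := conjNabla_quarterSymmetric (A := A) (ϖ := ϖ) hX hY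
  rw [← riemann_eq_riemannAt hX hY hZ, riemann_eq, lcNabla_mlieBracket hX hY]
  simp only [curvature3, Pi.sub_apply, Pi.add_apply, nabla_quarterSymmetric]
  rw [(conjNabla_quarterSymmetric hX (hY.twistedNabla hZ hA hϖ 1 0)).eq_of_nhds,
    twistedNabla_congr (hX.twistedNabla hZ hA hϖ 0 1) hXZ,
    (conjNabla_quarterSymmetric (hY.twistedNabla hX hA hϖ 1 0) hZ).eq_of_nhds,
    twistedNabla_left_congr hXY.eq_of_nhds,
    twistedNabla_twistedNabla hA hϖ hX hY hZ, twistedNabla_twistedNabla hA hϖ hY hX hZ]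
  simp only [twistedNabla_apply, nabla, map_sub, map_smul, hA.sq, smul_eq_mul]
  module

end QuarterSymmetric

section Traces

variable {E : Type*} [NormedAddCommGroup E] [NormedSpace ℝ E] [FiniteDimensional ℝ E]
  {H : Type*} [TopologicalSpace H] {I : ModelWithCorners ℝ E H}
  {M : Type*} [TopologicalSpace M] [ChartedSpace H M] [IsManifold I ∞ M] {x : M}

lemma traceAt_add (f g : TangentSpace I x → TangentSpace I x) :
    traceAt x (fun v ↦ f v + g v) = traceAt x f + traceAt x g := by
  simp [traceAt, Finset.sum_add_distrib]

lemma traceAt_sub (f g : TangentSpace I x → TangentSpace I x) :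
    traceAt x (fun v ↦ f v - g v) = traceAt x f - traceAt x g := by
  simp [traceAt, Finset.sum_sub_distrib]

lemma traceAt_const_smul (c : ℝ) (f : TangentSpace I x → TangentSpace I x) :
    traceAt x (fun v ↦ c • f v) = c * traceAt x f := by
  simp [traceAt, Finset.mul_sum]

lemma traceAt_form_smul (α : TangentSpace I x →L[ℝ] ℝ) (w : TangentSpace I x) :
    traceAt x (fun v ↦ α v • w) = α w := by
  conv_rhs => rw [← (finBasis ℝ (TangentSpace I x)).sum_repr w, map_sum]
  simp [traceAt, mul_comm]

lemma traceAt_const_smul_id (c : ℝ) :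
    traceAt x (fun v : TangentSpace I x ↦ c • v) = c * finrank ℝ (TangentSpace I x) := by
  rw [traceAt_const_smul c fun v ↦ v]
  exact congrArg (c * ·) ((traceAt_linearMap x LinearMap.id).trans (LinearMap.trace_id ..))

lemma traceAt_comp_comm (S T : TangentSpace I x →ₗ[ℝ] TangentSpace I x) :
    traceAt x (fun v ↦ S (T v)) = traceAt x (fun v ↦ T (S v)) := by
  have h := LinearMap.trace_mul_comm ℝ S T
  rw [← traceAt_linearMap, ← traceAt_linearMap] at h
  exact h

variable [RiemannianBundle (fun x : M ↦ TangentSpace I x)]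
  [IsContMDiffRiemannianBundle I ∞ E (fun x : M ↦ TangentSpace I x)]

lemma traceAt_eq_sum_inner (T : TangentSpace I x →ₗ[ℝ] TangentSpace I x) :
    traceAt x T = ∑ i, inner ℝ (stdOrthonormalBasis ℝ (TangentSpace I x) i)
      (T (stdOrthonormalBasis ℝ (TangentSpace I x) i)) := by
  rw [traceAt_linearMap]
  exact LinearMap.trace_eq_sum_inner T (stdOrthonormalBasis ℝ (TangentSpace I x))

/-- Skew-adjoint maps have trace zero. -/
lemma traceAt_eq_zero_of_skew (T : TangentSpace I x →ₗ[ℝ] TangentSpace I x)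
    (hT : ∀ v, inner ℝ v (T v) = 0) : traceAt x T = 0 := by
  rw [traceAt_eq_sum_inner]
  exact Finset.sum_eq_zero fun i _ ↦ hT _

variable {A : Π x : M, TangentSpace I x →L[ℝ] TangentSpace I x}

lemma traceAt_app (hA : IsKahler A) : traceAt x (fun v ↦ A x v) = 0 := by
  refine traceAt_eq_zero_of_skew (A x : TangentSpace I x →ₗ[ℝ] TangentSpace I x) fun v ↦ ?_
  have h := hA.isometry x v (A x v)
  rw [hA.sq, inner_neg_right, real_inner_comm] at h
  simp only [ContinuousLinearMap.coe_coe]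
  linarith

lemma traceAt_riemannAt (u v : TangentSpace I x) :
    traceAt x (fun w ↦ riemannAt I x u v w) = 0 := by
  refine traceAt_eq_zero_of_skew (riemannAt I x u v) fun w ↦ ?_
  have h := riemannAt_skew u v w w
  rw [real_inner_comm]
  linarith

variable (I) in
/-- The value of the Ricci tensor on tangent vectors at `x`. -/
def ricAt (x : M) (v w : TangentSpace I x) : ℝ := traceAt x fun u ↦ riemannAt I x u v w

lemma ricAt_symm (v w : TangentSpace I x) : ricAt I x v w = ricAt I x w v := by
  have h (v w : TangentSpace I x) := traceAt_eq_sum_inner (((riemannAt I x).flip v).flip w)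
  refine (h v w).trans (Eq.trans (Finset.sum_congr rfl fun i _ ↦ ?_) (h w v).symm)
  set e := stdOrthonormalBasis ℝ (TangentSpace I x) i
  simp only [LinearMap.flip_apply]
  rw [real_inner_comm, riemannAt_pair_symm, riemannAt_swap, inner_neg_left, riemannAt_skew,
    neg_neg, real_inner_comm]

lemma ricAt_neg_right (v w : TangentSpace I x) : ricAt I x v (-w) = -ricAt I x v w := by
  have h := traceAt_const_smul (-1) (fun u ↦ riemannAt I x u v w)
  simpa [ricAt] using h

lemma riemannAt_app_app (hA : IsKahler A) (u v w : TangentSpace I x) :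
    riemannAt I x (A x u) (A x v) w = riemannAt I x u v w := by
  refine ext_inner_right ℝ fun z ↦ ?_
  rw [riemannAt_pair_symm, riemannAt_app hA, hA.isometry, ← riemannAt_pair_symm]

lemma ricAt_app_app (hA : IsKahler A) (v w : TangentSpace I x) :
    ricAt I x (A x v) (A x w) = ricAt I x v w := by
  have h := traceAt_comp_comm (A x : TangentSpace I x →ₗ[ℝ] TangentSpace I x)
    (((riemannAt I x).flip (A x v)).flip w)
  simp only [LinearMap.flip_apply, ContinuousLinearMap.coe_coe, riemannAt_app_app hA] at h
  simpa only [ricAt, riemannAt_app hA] using h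

lemma ricAt_app_left (hA : IsKahler A) (v w : TangentSpace I x) :
    ricAt I x (A x v) w = -ricAt I x v (A x w) := by
  rw [← ricAt_app_app hA v (A x w), hA.sq, ricAt_neg_right, neg_neg]

variable {X Y Z : Π x : M, TangentSpace I x} {ϖ : Π x : M, TangentSpace I x →L[ℝ] ℝ}

lemma ricciG_eq_ricAt (hY : SmoothFieldAt Y x) (hZ : SmoothFieldAt Z x) :
    ricciG I Y Z x = ricAt I x (Y x) (Z x) := by
  have h (v : TangentSpace I x) : riemann I (FiberBundle.extend E v) Y Z x =
      riemannAt I x v (Y x) (Z x) := by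
    rw [riemann_eq_riemannAt (smoothFieldAt_extend v) hY hZ, FiberBundle.extend_apply_self]
  simp only [ricciG, ricci, ricAt, h]

lemma ricci_curvature1_quarterSymmetric (hA : IsKahler A) (hϖ : SmoothOneForm ϖ)
    (hY : SmoothFieldAt Y x) (hZ : SmoothFieldAt Z x) :
    ricci (curvature1 (quarterSymmetric A ϖ)) Y Z x = ricAt I x (Y x) (Z x)
      - (formDerivAt hϖ x (A x (Z x)) (Y x) - formDerivAt hϖ x (Y x) (A x (Z x))) := by
  simp only [ricci, curvature1_quarterSymmetric hA hϖ (smoothFieldAt_extend _) hY hZ,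
    FiberBundle.extend_apply_self, traceAt_sub]
  rw [← ricAt]
  congr 1
  exact traceAt_form_smul ((formDerivAt hϖ x).flip (Y x) - formDerivAt hϖ x (Y x)) _

lemma ricci_curvature0_quarterSymmetric (hA : IsKahler A) (hϖ : SmoothOneForm ϖ)
    (hY : SmoothFieldAt Y x) (hZ : SmoothFieldAt Z x) :
    ricci (curvature0 (quarterSymmetric A ϖ)) Y Z x = ricAt I x (Y x) (Z x)
      - 1 / 2 * (formDerivAt hϖ x (A x (Z x)) (Y x) - formDerivAt hϖ x (Y x) (A x (Z x))
        + formDerivAt hϖ x (A x (Y x)) (Z x))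
      + (finrank ℝ (TangentSpace I x) : ℝ) / 4 * (ϖ x (Y x) * ϖ x (Z x))
      - 1 / 4 * (ϖ x (A x (Y x)) * ϖ x (A x (Z x))) := by
  let D := formDerivAt hϖ x
  have t1 := traceAt_form_smul (D.flip (Y x) - D (Y x)) (A x (Z x))
  have t2 := traceAt_form_smul (D.flip (Z x)) (A x (Y x))
  have t3 := traceAt_form_smul (ϖ x (Z x) • ϖ x) (Y x)
  have t4 := traceAt_form_smul (ϖ x (A x (Z x)) • ϖ x + ϖ x (Z x) • (ϖ x).comp (A x)) (A x (Y x))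
  simp only [sub_apply, ContinuousLinearMap.flip_apply,
    add_apply, smul_apply, ContinuousLinearMap.comp_apply,
    smul_eq_mul, hA.sq, map_neg, D] at t1 t2 t3 t4
  simp only [ricci, curvature0_quarterSymmetric hA hϖ (smoothFieldAt_extend _) hY hZ,
    FiberBundle.extend_apply_self, traceAt_sub, traceAt_add, traceAt_const_smul, traceAt_const_smul_id,
    traceAt_app hA, mul_comm (ϖ x _) (ϖ x (Z x)), mul_comm (ϖ x _) (ϖ x (A x (Z x))), t1, t2, t3,
    t4]
  rw [← ricAt]
  ring

lemma ricci_curvature3_quarterSymmetric (hA : IsKahler A) (hϖ : SmoothOneForm ϖ)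
    (hY : SmoothFieldAt Y x) (hZ : SmoothFieldAt Z x) :
    ricci (curvature3 (quarterSymmetric A ϖ)) Y Z x = ricAt I x (Y x) (Z x)
      - formDerivAt hϖ x (A x (Z x)) (Y x) + ϖ x (Y x) * ϖ x (Z x) := by
  have t1 := traceAt_form_smul ((formDerivAt hϖ x).flip (Y x)) (A x (Z x))
  have t2 := traceAt_form_smul ((ϖ x).comp (A x)) (A x (Z x))
  simp only [ContinuousLinearMap.flip_apply, ContinuousLinearMap.comp_apply, hA.sq, map_neg]
    at t1 t2
  simp only [ricci, curvature3_quarterSymmetric hA hϖ (smoothFieldAt_extend _) hY hZ,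
    FiberBundle.extend_apply_self, traceAt_sub, traceAt_add, traceAt_const_smul,
    traceAt_app hA, t1, t2]
  rw [← ricAt]
  ring

lemma primeTrace_curvature3_quarterSymmetric (hA : IsKahler A) (hϖ : SmoothOneForm ϖ)
    (hX : SmoothFieldAt X x) (hY : SmoothFieldAt Y x) :
    primeTrace (curvature3 (quarterSymmetric A ϖ)) X Y x =
      formDerivAt hϖ x (Y x) (A x (X x)) - ϖ x (Y x) * ϖ x (X x) := by
  have t1 := traceAt_form_smul (formDerivAt hϖ x (Y x)) (A x (X x))
  have t2 := traceAt_form_smul ((ϖ x).comp (A x)) (A x (X x))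
  simp only [ContinuousLinearMap.comp_apply, hA.sq, map_neg] at t2
  simp only [primeTrace, curvature3_quarterSymmetric hA hϖ hX hY (smoothFieldAt_extend _),
    FiberBundle.extend_apply_self, traceAt_sub, traceAt_add, traceAt_const_smul,
    traceAt_app hA, traceAt_riemannAt, t1, t2]
  ring

end Traces

section GeneratorIndependence

variable {n : ℕ} {M : Type*} [TopologicalSpace M]
  [ChartedSpace (EuclideanSpace ℝ (Fin n)) M] [IsManifold (𝓡 n) ∞ M]
  [RiemannianBundle (fun x : M ↦ TangentSpace (𝓡 n) x)]
  [IsContMDiffRiemannianBundle (𝓡 n) ∞ (EuclideanSpace ℝ (Fin n))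
    (fun x : M ↦ TangentSpace (𝓡 n) x)]
  {A : Π x : M, TangentSpace (𝓡 n) x →L[ℝ] TangentSpace (𝓡 n) x}
  {ϖ : Π x : M, TangentSpace (𝓡 n) x →L[ℝ] ℝ} {x : M} {X Y Z : Π x : M, TangentSpace (𝓡 n) x}

lemma finrank_tangentSpace : finrank ℝ (TangentSpace (𝓡 n) x) = n :=
  finrank_euclideanSpace_fin

lemma tensorH0_eq (hn : 2 ≤ n) (hA : IsKahler A) (hϖ : SmoothOneForm ϖ)
    (hX : SmoothFieldAt X x) (hY : SmoothFieldAt Y x) (hZ : SmoothFieldAt Z x) :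
    tensorH0 A ϖ X Y Z x = riemann (𝓡 n) X Y Z x
      + (1 / (4 * ((n : ℝ) - 1))) • (ricciG (𝓡 n) X Z x • Y x - ricciG (𝓡 n) Y Z x • X x)
      + (1 / 4 : ℝ) • ((2 * ricciG (𝓡 n) (app A X) Y x) • app A Z x
        + ricciG (𝓡 n) (app A X) Z x • app A Y x - ricciG (𝓡 n) (app A Y) Z x • app A X x) := by
  have hAX := hX.app hA
  have hAY := hY.app hA
  have hAZ := hZ.app hA
  have happ (U : Π x : M, TangentSpace (𝓡 n) x) : app A U x = A x (U x) := rfl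
  simp only [tensorH0, curvature0_quarterSymmetric hA hϖ hX hY hZ,
    ricci_curvature0_quarterSymmetric hA hϖ hX hZ, ricci_curvature0_quarterSymmetric hA hϖ hY hZ,
    ricci_curvature1_quarterSymmetric hA hϖ hX hZ, ricci_curvature1_quarterSymmetric hA hϖ hY hZ,
    ricci_curvature1_quarterSymmetric hA hϖ hY hAX,
    ricci_curvature3_quarterSymmetric hA hϖ hZ hX, ricci_curvature3_quarterSymmetric hA hϖ hZ hY,
    ricci_curvature3_quarterSymmetric hA hϖ hZ hAX, ricci_curvature3_quarterSymmetric hA hϖ hZ hAY,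
    primeTrace_curvature3_quarterSymmetric hA hϖ hAZ hAX,
    primeTrace_curvature3_quarterSymmetric hA hϖ hAZ hAY,
    primeTrace_curvature3_quarterSymmetric hA hϖ hAZ hX,
    primeTrace_curvature3_quarterSymmetric hA hϖ hAZ hY,
    riemann_eq_riemannAt hX hY hZ, ricciG_eq_ricAt hX hZ, ricciG_eq_ricAt hY hZ,
    ricciG_eq_ricAt hAX hY, ricciG_eq_ricAt hAX hZ, ricciG_eq_ricAt hAY hZ, finrank_tangentSpace,
    happ, hA.sq, map_neg, neg_apply, ricAt_symm (Z x),
    ricAt_symm (Y x) (A x (X x))]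
  obtain ⟨k, hk⟩ : ∃ k : ℝ, (n : ℝ) = k + 1 := ⟨n - 1, by ring⟩
  have hk0 : k ≠ 0 := by
    have : (2 : ℝ) ≤ n := by exact_mod_cast hn
    intro h
    linarith
  rw [hk, add_sub_cancel_right]
  match_scalars <;> field_simp <;> ring

lemma holProjective_sub_weylProjective (hn : 2 ≤ n) (hA : IsKahler A)
    (hX : SmoothFieldAt X x) (hY : SmoothFieldAt Y x) (hZ : SmoothFieldAt Z x) :
    (((n : ℝ) + 2) / 4) • holProjective A X Y Z x - (((n : ℝ) - 2) / 4) • weylProjective X Y Z x =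
      riemann (𝓡 n) X Y Z x
      + (1 / (4 * ((n : ℝ) - 1))) • (ricciG (𝓡 n) X Z x • Y x - ricciG (𝓡 n) Y Z x • X x)
      + (1 / 4 : ℝ) • ((2 * ricciG (𝓡 n) (app A X) Y x) • app A Z x
        + ricciG (𝓡 n) (app A X) Z x • app A Y x - ricciG (𝓡 n) (app A Y) Z x • app A X x) := by
  have hAX := hX.app hA
  have hAY := hY.app hA
  have hAZ := hZ.app hA
  have happ (U : Π x : M, TangentSpace (𝓡 n) x) : app A U x = A x (U x) := rfl
  simp only [holProjective, weylProjective, ricciG_eq_ricAt hAX hY, ricciG_eq_ricAt hAX hZ,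
    ricciG_eq_ricAt hAY hZ, ricciG_eq_ricAt hX hAZ, ricciG_eq_ricAt hY hAZ,
    ricciG_eq_ricAt hX hAY, happ, ricAt_app_left hA]
  have h2 : (2 : ℝ) ≤ n := by exact_mod_cast hn
  have h1 : (n : ℝ) - 1 ≠ 0 := by linarith
  have h3 : (n : ℝ) + 2 ≠ 0 := by linarith
  match_scalars <;> field_simp <;> ring

end GeneratorIndependence

end KahlerQS

end

theorem mainTheorem5 {n : ℕ} (hn : 4 ≤ n) {M : Type*} [TopologicalSpace M]
    [ChartedSpace (EuclideanSpace ℝ (Fin n)) M] [IsManifold (𝓡 n) ∞ M]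
    [RiemannianBundle (fun x : M ↦ TangentSpace (𝓡 n) x)]
    [IsContMDiffRiemannianBundle (𝓡 n) ∞ (EuclideanSpace ℝ (Fin n))
      (fun x : M ↦ TangentSpace (𝓡 n) x)]
    (A : Π x : M, TangentSpace (𝓡 n) x →L[ℝ] TangentSpace (𝓡 n) x)
    (hA : KahlerQS.IsKahler A) (x : M) (X Y Z : Π x : M, TangentSpace (𝓡 n) x)
    (hX : KahlerQS.SmoothFieldAt X x) (hY : KahlerQS.SmoothFieldAt Y x)
    (hZ : KahlerQS.SmoothFieldAt Z x) :
    (∀ ϖ ϖ' : Π x : M, TangentSpace (𝓡 n) x →L[ℝ] ℝ,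
      KahlerQS.SmoothOneForm ϖ → KahlerQS.SmoothOneForm ϖ' →
        KahlerQS.tensorH0 A ϖ X Y Z x = KahlerQS.tensorH0 A ϖ' X Y Z x) ∧
    (∀ ϖ : Π x : M, TangentSpace (𝓡 n) x →L[ℝ] ℝ, KahlerQS.SmoothOneForm ϖ →
      KahlerQS.tensorH0 A ϖ X Y Z x =
        KahlerQS.riemann (𝓡 n) X Y Z x
        + (1 / (4 * ((n : ℝ) - 1))) •
          (KahlerQS.ricciG (𝓡 n) X Z x • Y x - KahlerQS.ricciG (𝓡 n) Y Z x • X x)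
        + (1 / 4 : ℝ) •
          ((2 * KahlerQS.ricciG (𝓡 n) (KahlerQS.app A X) Y x) • KahlerQS.app A Z x
            + KahlerQS.ricciG (𝓡 n) (KahlerQS.app A X) Z x • KahlerQS.app A Y x
            - KahlerQS.ricciG (𝓡 n) (KahlerQS.app A Y) Z x • KahlerQS.app A X x)) ∧
    (∀ ϖ : Π x : M, TangentSpace (𝓡 n) x →L[ℝ] ℝ, KahlerQS.SmoothOneForm ϖ →
      KahlerQS.tensorH0 A ϖ X Y Z x =
        (((n : ℝ) + 2) / 4) • KahlerQS.holProjective A X Y Z x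
        - (((n : ℝ) - 2) / 4) • KahlerQS.weylProjective X Y Z x) := by
  have h2 : 2 ≤ n := by omega
  refine ⟨fun ϖ ϖ' h h' ↦ ?_, fun ϖ h ↦ KahlerQS.tensorH0_eq h2 hA h hX hY hZ, fun ϖ h ↦ ?_⟩
  · rw [KahlerQS.tensorH0_eq h2 hA h hX hY hZ, KahlerQS.tensorH0_eq h2 hA h' hX hY hZ]
  · rw [KahlerQS.tensorH0_eq h2 hA h hX hY hZ,
      KahlerQS.holProjective_sub_weylProjective h2 hA hX hY hZ]
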